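/- Let $K$ be a field of characteristic $2$, let $\mathfrak m=(U,V,W,X,Y,Z)\subset K[U,V,W,X,Y,Z]$, and let $$A=K[U,V,W,X,Y,Z]_{\mathfrak m}/(UX+VY+WZ),$$ a local domain with fraction field $L$; write $u,v,w,x,y,z$ for the images of the variables in $A$, and let $P=(u,v,w)A$. In an algebraic closure of $L$ put $$a=\sqrt{uyz},\quad b=\sqrt{vxz},\quad c=\sqrt{wxy},\quad d=\sqrt{uvw},\quad e=\sqrt{vwyz},$$ and let $R=A[a,b,c,d,e]$. Then: 1. $R$ is a Gorenstein normal domain (a Noetherian ring is Gorenstein if its localization at every prime ideal has finite injective dimension over itself). 2. The field $L(\sqrt{uyz},\sqrt{vxz})$ is a biquadratic extension of $L$ (it has degree $4$ over $L$), and $R$ is the integral closure of $A$ in it. 3. $R$ is a finite $A$-module, generated by $1,a,b,c,d,e$, and has rank $4$ over $A$. 4. $P$ is a prime ideal, and there is an exact sequence of $A$-modules $$0\to A^3\to R\to P\to 0$$ in which the map $R\to P$ is determined by $1\mapsto 0$, $a\mapsto u$, $b\mapsto v$, $c\mapsto w$, $d\mapsto 0$, $e\mapsto 0$. -/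

import Mathlib

universe u

/-- A commutative ring is *Gorenstein* if it is Noetherian and each of its localizations at a prime
ideal has finite injective dimension as a module over itself. -/
structure IsGorensteinRing (R : Type u) [CommRing R] : Prop where
  isNoetherianRing : IsNoetherianRing R
  exists_injectiveDimensionLE (p : Ideal R) [p.IsPrime] : ∃ n : ℕ,
    CategoryTheory.HasInjectiveDimensionLE
      (ModuleCat.of (Localization.AtPrime p) (Localization.AtPrime p)) n

namespace QuadricHypersurface

open MvPolynomial

section

variable (K : Type u) [Field K]

/-- The polynomial ring `K[U, V, W, X, Y, Z]`; the variables `U, V, W` are those with index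
`Sum.inl 0`, `Sum.inl 1`, `Sum.inl 2` and `X, Y, Z` those with index `Sum.inr 0`, `Sum.inr 1`,
`Sum.inr 2`. -/
abbrev Poly : Type u := MvPolynomial (Fin 3 ⊕ Fin 3) K

/-- The maximal ideal `m = (U, V, W, X, Y, Z)` of the polynomial ring. -/
noncomputable abbrev maxIdeal : Ideal (Poly K) := Ideal.span (Set.range MvPolynomial.X)

theorem maxIdeal_eq_ker :
    maxIdeal K = RingHom.ker (constantCoeff : Poly K →+* K) := by
  ext p
  have h := mem_pow_idealOfVars_iff' (σ := Fin 3 ⊕ Fin 3) (R := K) 1 p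
  rw [pow_one] at h
  refine Iff.trans h ?_
  rw [RingHom.mem_ker, constantCoeff_eq]
  constructor
  · intro H
    exact H 0 (by simp)
  · intro H x hx
    have : x = 0 := by
      have : x.degree = 0 := by omega
      exact (Finsupp.degree_eq_zero_iff x).1 this
    rw [this, H]

instance maxIdeal_isPrime : (maxIdeal K).IsPrime := by
  rw [maxIdeal_eq_ker]
  exact RingHom.ker_isPrime _

/-- The regular local ring `K[U, V, W, X, Y, Z]_m`. -/
abbrev LocPoly : Type u := Localization.AtPrime (maxIdeal K)

/-- The quadratic form `UX + VY + WZ`. -/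
noncomputable def quadric : Poly K :=
  X (Sum.inl 0) * X (Sum.inr 0) + X (Sum.inl 1) * X (Sum.inr 1) + X (Sum.inl 2) * X (Sum.inr 2)

/-- The ideal generated by `UX + VY + WZ` in `K[U, V, W, X, Y, Z]_m`. -/
noncomputable abbrev quadricIdeal : Ideal (LocPoly K) :=
  Ideal.span {algebraMap (Poly K) (LocPoly K) (quadric K)}

theorem quadric_irreducible : Irreducible (quadric K) := by
  have h := irreducible_sumSMulXSMulY (n := Fin 3) (R := K)
    (Finsupp.equivFunOnFinite.symm (fun _ => (1 : K)))
    ⟨0, by simp, 1, by simp, by decide⟩ (fun r hr => isUnit_of_dvd_one (by simpa using hr 0))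
  have e : sumSMulXSMulY (Finsupp.equivFunOnFinite.symm (fun _ : Fin 3 => (1 : K)))
      = quadric K := by
    rw [sumSMulXSMulY, Finsupp.linearCombination_apply, Finsupp.sum_fintype _ _ (by simp)]
    simp [Fin.sum_univ_three, quadric]
  rwa [e] at h

theorem quadric_mem : quadric K ∈ maxIdeal K := by
  have h : ∀ i, (X i : Poly K) ∈ maxIdeal K := fun i => Ideal.subset_span ⟨i, rfl⟩
  exact Ideal.add_mem _ (Ideal.add_mem _ (Ideal.mul_mem_right _ _ (h _))
    (Ideal.mul_mem_right _ _ (h _))) (Ideal.mul_mem_right _ _ (h _))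

instance quadricIdeal_isPrime : (quadricIdeal K).IsPrime := by
  have hp : (Ideal.span {quadric K} : Ideal (Poly K)).IsPrime :=
    (Ideal.span_singleton_prime (quadric_irreducible K).ne_zero).2 (quadric_irreducible K).prime
  have h := IsLocalization.isPrime_of_isPrime_disjoint (maxIdeal K).primeCompl (LocPoly K)
    (Ideal.span {quadric K}) hp (by
      rw [Set.disjoint_left]
      intro x hx hx'
      exact hx ((Ideal.span_singleton_le_iff_mem _).2 (quadric_mem K) hx'))
  rwa [Ideal.map_span, Set.image_singleton] at h

/-- The local hypersurface `A = K[U, V, W, X, Y, Z]_m / (UX + VY + WZ)`. -/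
def A : Type u := LocPoly K ⧸ quadricIdeal K

noncomputable instance : CommRing (A K) := inferInstanceAs (CommRing (LocPoly K ⧸ quadricIdeal K))

instance : IsDomain (A K) := Ideal.Quotient.isDomain (quadricIdeal K)

/-- The quotient map from `K[U, V, W, X, Y, Z]_m` to `A`. -/
noncomputable def toA : LocPoly K →+* A K := Ideal.Quotient.mk (quadricIdeal K)

/-- The images `u, v, w, x, y, z` in `A` of the variables. -/
noncomputable def coord (i : Fin 3 ⊕ Fin 3) : A K := toA K (algebraMap (Poly K) (LocPoly K) (X i))

noncomputable def u : A K := coord K (Sum.inl 0)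
noncomputable def v : A K := coord K (Sum.inl 1)
noncomputable def w : A K := coord K (Sum.inl 2)
noncomputable def x : A K := coord K (Sum.inr 0)
noncomputable def y : A K := coord K (Sum.inr 1)
noncomputable def z : A K := coord K (Sum.inr 2)

/-- The ideal `P = (u, v, w)` of `A`. -/
noncomputable def P : Ideal (A K) := Ideal.span {u K, v K, w K}

/-- The fraction field `L` of `A`. -/
abbrev L : Type u := FractionRing (A K)

/-- An algebraic closure of `L`. -/
abbrev Ω : Type u := AlgebraicClosure (L K)

variable {K}

/-- A square root of `f`, an element of `A`, in the algebraic closure of `L`. (In characteristic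
two it is the only one.) -/
noncomputable def sqrt (f : A K) : Ω K :=
  (IsAlgClosed.exists_pow_nat_eq (algebraMap (A K) (Ω K) f) two_pos).choose

theorem sqrt_sq (f : A K) : sqrt f ^ 2 = algebraMap (A K) (Ω K) f :=
  (IsAlgClosed.exists_pow_nat_eq (algebraMap (A K) (Ω K) f) two_pos).choose_spec

variable (K)

noncomputable def a : Ω K := sqrt (u K * y K * z K)
noncomputable def b : Ω K := sqrt (v K * x K * z K)
noncomputable def c : Ω K := sqrt (w K * x K * y K)
noncomputable def d : Ω K := sqrt (u K * v K * w K)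
noncomputable def e : Ω K := sqrt (v K * w K * y K * z K)

/-- The ring `R = A[a, b, c, d, e]`. -/
noncomputable def R : Subalgebra (A K) (Ω K) := Algebra.adjoin (A K) {a K, b K, c K, d K, e K}

theorem a_mem : a K ∈ R K := Algebra.subset_adjoin (by simp)
theorem b_mem : b K ∈ R K := Algebra.subset_adjoin (by simp)
theorem c_mem : c K ∈ R K := Algebra.subset_adjoin (by simp)
theorem d_mem : d K ∈ R K := Algebra.subset_adjoin (by simp)
theorem e_mem : e K ∈ R K := Algebra.subset_adjoin (by simp)

/-- The field `L(√(uyz), √(vxz))`. -/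
noncomputable def M : IntermediateField (L K) (Ω K) := IntermediateField.adjoin (L K) {a K, b K}

end

end QuadricHypersurface

-- In characteristic 2 squaring is additive and injective, so an identity between the radicals may
-- be checked on squares, modulo the quadric. This gives `z c = x a + y b`, `z d = v a + u b`,
-- similar formulas for `x d` and `y d`, and a multiplication table that makes the span of `1, a, b,
-- c, d, e` a ring inside `M = L(a, b)`.
--
-- Integral closure: `A` is normal by Nagata's criterion, since `u` is prime and `A[1/u]` is a
-- localization of a polynomial ring. If `h = ∑ cᵢ mᵢ`, with `m = (1, a, b, ab)`, is integral over
-- `A`, then `h² = ∑ cᵢ² mᵢ²` lies in `A`. Derivations of `A` kill squares, so suitable ones isolate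
-- single terms of this sum; primality of the coordinates and normality then give `z³ cᵢ ∈ A`
-- (`pow_three_mul_mem_range`). The same argument shows that `1, a, b, ab` are independent over `L`.
-- Hence `z³ h ∈ R`, and `y³ h ∈ R` by using `a, c` instead of `a, b`. Since `y³, z³` is a regular
-- sequence on `R`, it follows that `h ∈ R`.
--
-- Gorenstein property: let `B` be `K[T, V, W, Y, Z]` localized at the origin, with `T ↦ u + x`. As
-- `x² = (u + x) x + (vy + wz)`, `A` is free over `B` on `1, x`; moreover `R` is free on `1, x, e,
-- xe, a, b, c, d`, and the form reading off the coefficient of `xe` admits an explicit dual basis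
-- (`exists_dual`). So `R ≅ Hom_B(R, B)`. Because `Hom_B(R, -)` is exact and preserves injectives,
-- the finite injective dimension of `B`, which comes from Hilbert's syzygy theorem, passes to `R`
-- and to its localizations.
--
-- Exact sequence: an `L`-linear form on `M` restricts to the map `R → P`. Its kernel is governed by
-- the syzygies of `u, v, w`, which are the Koszul ones together with `(x, y, z)`. The former turn
-- `(a, b, c)` into multiples of `d`, the latter kills it, so the kernel is free on `1, e, d`.

universe v

/-! ### Injective dimension under localization and Frobenius extensions -/

section HomologicalAlgebra

open CategoryTheory TensorProduct

theorem ModuleCat.shortExact_of_linearMap {R : Type u} [Ring R] {M N P : Type v} [AddCommGroup M]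
    [AddCommGroup N] [AddCommGroup P] [Module R M] [Module R N] [Module R P]
    (f : M →ₗ[R] N) (g : N →ₗ[R] P) (hf : Function.Injective f) (hfg : Function.Exact f g)
    (hg : Function.Surjective g) :
    (ShortComplex.mk (ModuleCat.ofHom f) (ModuleCat.ofHom g) (by
      ext x; exact hfg.apply_apply_eq_zero x)).ShortExact where
  exact := (ShortComplex.ShortExact.moduleCat_exact_iff_function_exact _).2 hfg
  mono_f := (ModuleCat.mono_iff_injective _).2 hf
  epi_g := (ModuleCat.epi_iff_surjective _).2 hg

/-- Injective dimension does not go up under a functor that preserves injective objects and short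
exact sequences. -/
theorem CategoryTheory.Functor.hasInjectiveDimensionLE_obj {C D : Type*} [Category C] [Category D]
    [Abelian C] [Abelian D] [EnoughInjectives C] (F : C ⥤ D) [F.PreservesZeroMorphisms]
    [F.PreservesInjectiveObjects]
    (hF : ∀ S : ShortComplex C, S.ShortExact → (S.map F).ShortExact) (n : ℕ) (X : C)
    [hX : HasInjectiveDimensionLE X n] : HasInjectiveDimensionLE (F.obj X) n := by
  induction n generalizing X with
  | zero =>
    simp only [HasInjectiveDimensionLE, zero_add, ← injective_iff_hasInjectiveDimensionLT_one]
      at hX ⊢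
    exact F.injective_obj_of_injective hX
  | succ n ih =>
    -- Dimension shift: the cokernel of an embedding into an injective has dimension one less, and
    -- `F` keeps the sequence short exact with injective middle term.
    obtain ⟨⟨I, inj, f, _⟩⟩ := EnoughInjectives.presentation X
    let T := ShortComplex.mk f (Limits.cokernel.π f) (Limits.cokernel.condition f)
    have hT : T.ShortExact := { exact := ShortComplex.exact_cokernel f }
    have := (hT.hasInjectiveDimensionLT_X₃_iff n ‹_›).mpr hX
    exact ((hF T hT).hasInjectiveDimensionLT_X₃_iff n (F.injective_obj_of_injective inj)).mp
      (ih T.X₃)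

theorem hasInjectiveDimensionLE_localization {R : Type u} [CommRing R] [IsNoetherianRing R]
    (S : Submonoid R) (n : ℕ) (h : HasInjectiveDimensionLE (ModuleCat.of R R) n) :
    HasInjectiveDimensionLE (ModuleCat.of (Localization S) (Localization S)) n := by
  have h1 := ModuleCat.localizedModule_hasInjectiveDimensionLE n S (ModuleCat.of R R)
  have := ModuleCat.localizedModule_isLocalizedModule (ModuleCat.of R R) S
  have e : (ModuleCat.of R R).localizedModule S ≃ₗ[R] Localization S :=
    IsLocalizedModule.linearEquiv S ((ModuleCat.of R R).localizedModuleMkLinearMap S)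
      (Algebra.linearMap R (Localization S))
  exact (ModuleCat.hasInjectiveDimensionLE_iff_of_linearEquiv
    (N := ModuleCat.of (Localization S) (Localization S))
    (LinearEquiv.extendScalarsOfIsLocalization S (Localization S) e) n).1 h1

/-- If `R` is projective as a `B`-module and `R ≅ Hom_B(R, B)` via a linear form, then the self
injective dimension of `R` is bounded by that of `B`. -/
theorem hasInjectiveDimensionLE_of_frobenius {B R : Type u} [CommRing B] [CommRing R] [Algebra B R]
    [Module.Projective B R] (φ : R →ₗ[B] B)
    (hφ : Function.Bijective fun r : R => φ ∘ₗ LinearMap.mulRight B r) (n : ℕ)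
    (h : HasInjectiveDimensionLE (ModuleCat.of B B) n) :
    HasInjectiveDimensionLE (ModuleCat.of R R) n := by
  let f := algebraMap B R
  -- `F` is `Hom_B(R, -)`. It is right adjoint to restriction of scalars, which preserves
  -- monomorphisms, so it preserves injectives; it is exact because `R` is projective over `B`.
  let F := ModuleCat.coextendScalars.{u, u, u} f
  have : F.PreservesZeroMorphisms := ⟨fun _ _ ↦ rfl⟩
  have : F.PreservesInjectiveObjects :=
    Functor.preservesInjectiveObjects_of_adjunction_of_preservesMonomorphisms
      (ModuleCat.restrictCoextendScalarsAdj.{u} f)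
  let e₀ : R ≃ₗ[B] (ModuleCat.restrictScalars f).obj (ModuleCat.of R R) :=
    { AddEquiv.refl R with map_smul' := fun b r => Algebra.smul_def b r }
  have hp : Module.Projective B ((ModuleCat.restrictScalars f).obj (ModuleCat.of R R)) :=
    Module.Projective.of_equiv e₀
  have hF : ∀ S : ShortComplex (ModuleCat.{u} B), S.ShortExact → (S.map F).ShortExact := by
    intro S hS
    have h1 := hS.moduleCat_injective_f
    have h2 := (ShortComplex.ShortExact.moduleCat_exact_iff_function_exact _).1 hS.exact
    have h3 := hS.moduleCat_surjective_g
    refine { exact := ?_, mono_f := ?_, epi_g := ?_ }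
    · refine (ShortComplex.ShortExact.moduleCat_exact_iff_function_exact _).2 fun k => ⟨fun hk => ?_, ?_⟩
      · have hk' : ∀ s, S.g.hom (ModuleCat.CoextendScalars.equiv f _ k s) = 0 := fun s =>
          LinearMap.congr_fun (congrArg (ModuleCat.CoextendScalars.equiv f _) hk) s
        obtain ⟨l, hl⟩ := Module.projective_lifting_property S.f.hom.rangeRestrict
          (LinearMap.codRestrict _ (ModuleCat.CoextendScalars.equiv f _ k)
            fun s => (h2 _).1 (hk' s)) S.f.hom.surjective_rangeRestrict
        exact ⟨(ModuleCat.CoextendScalars.equiv f _).symm l, ModuleCat.CoextendScalars.ext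
          (LinearMap.ext fun s => congrArg Subtype.val (LinearMap.congr_fun hl s))⟩
      · rintro ⟨l, rfl⟩
        refine ModuleCat.CoextendScalars.ext (LinearMap.ext fun s => ?_)
        exact h2.apply_apply_eq_zero _
    · refine (ModuleCat.mono_iff_injective _).2 fun k l hkl => ?_
      refine ModuleCat.CoextendScalars.ext (LinearMap.ext fun s => h1 ?_)
      exact LinearMap.congr_fun (congrArg (ModuleCat.CoextendScalars.equiv f _) hkl) s
    · refine (ModuleCat.epi_iff_surjective _).2 fun k => ?_
      obtain ⟨l, hl⟩ := Module.projective_lifting_property S.g.hom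
        (ModuleCat.CoextendScalars.equiv f _ k) h3
      exact ⟨(ModuleCat.CoextendScalars.equiv f _).symm l, ModuleCat.CoextendScalars.ext hl⟩
  have h1 := F.hasInjectiveDimensionLE_obj hF n (ModuleCat.of B B)
  -- The map `r ↦ φ(· r)` is `R`-linear, and by `hφ` it identifies `R` with `Hom_B(R, B)`.
  let e₁ : R →ₗ[R] F.obj (ModuleCat.of B B) :=
    { toFun r := (ModuleCat.CoextendScalars.equiv f _).symm
        ((φ ∘ₗ LinearMap.mulRight B r) ∘ₗ e₀.symm.toLinearMap)
      map_add' r s := ModuleCat.CoextendScalars.ext (LinearMap.ext fun t =>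
        (congrArg φ (mul_add (e₀.symm t) r s)).trans (map_add φ _ _))
      map_smul' r s := ModuleCat.CoextendScalars.ext (LinearMap.ext fun t =>
        congrArg φ (mul_assoc (e₀.symm t) r s).symm) }
  have he₁ : Function.Bijective e₁ :=
    (ModuleCat.CoextendScalars.equiv f _).symm.bijective.comp
      ((LinearEquiv.congrLeft B B e₀).bijective.comp hφ)
  exact (ModuleCat.hasInjectiveDimensionLE_iff_of_linearEquiv (LinearEquiv.ofBijective e₁ he₁) n).2
    h1

end HomologicalAlgebra

/-! ### Finite global dimension of polynomial rings -/

section Syzygy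

open CategoryTheory TensorProduct Polynomial

theorem hasProjectiveDimensionLE_baseChange {R S : Type u} [CommRing R] [CommRing S] [Algebra R S]
    [Module.Flat R S] (n : ℕ) (M : Type u) [AddCommGroup M] [Module R M]
    (h : HasProjectiveDimensionLE (ModuleCat.of R M) n) :
    HasProjectiveDimensionLE (ModuleCat.of S (S ⊗[R] M)) n := by
  induction n generalizing M with
  | zero =>
    simp only [HasProjectiveDimensionLE, zero_add, ← projective_iff_hasProjectiveDimensionLT_one,
      ← IsProjective.iff_projective] at h ⊢
    infer_instance
  | succ n ih =>
    obtain ⟨Q, _, _, _, f, hf⟩ : ∃ (Q : Type u) (_ : AddCommGroup Q) (_ : Module R Q)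
        (_ : Module.Projective R Q) (f : Q →ₗ[R] M), Function.Surjective f :=
      ⟨M →₀ R, inferInstance, inferInstance, inferInstance, Finsupp.linearCombination R id,
        Finsupp.linearCombination_id_surjective R M⟩
    have hS := LinearMap.shortExact_shortComplexKer hf
    have p₁ : Projective (ModuleCat.of R Q) :=
      (IsProjective.iff_projective _).1 inferInstance
    have p₂ : Projective (ModuleCat.of S (S ⊗[R] Q)) :=
      (IsProjective.iff_projective _).1 inferInstance
    have hT := ModuleCat.shortExact_of_linearMap (R := S) ((LinearMap.ker f).subtype.baseChange S)
      (f.baseChange S)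
      (Module.Flat.lTensor_preserves_injective_linearMap (M := S) _ (Submodule.subtype_injective _))
      (lTensor_exact S (LinearMap.exact_subtype_ker_map f) hf)
      (LinearMap.lTensor_surjective S hf)
    exact (hT.hasProjectiveDimensionLT_X₃_iff n p₂).mpr
      (ih _ ((hS.hasProjectiveDimensionLT_X₃_iff n p₁).mp h))

namespace Polynomial

variable {R : Type u} [CommRing R] (M : Type u) [AddCommGroup M] [Module R M] [Module R[X] M]
  [IsScalarTower R R[X] M]

/-- Multiplication by `X` as an `R`-linear endomorphism. -/
noncomputable def xEnd : M →ₗ[R] M := LinearMap.restrictScalars R (LinearMap.lsmul R[X] M X)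

@[simp] theorem xEnd_apply (m : M) : xEnd (R := R) M m = (X : R[X]) • m := rfl

/-- The map `X ⊗ 1 - 1 ⊗ X` on `R[X] ⊗ M`. -/
noncomputable def tensorDiff : R[X] ⊗[R] M →ₗ[R[X]] R[X] ⊗[R] M :=
  LinearMap.lsmul R[X] _ X - (xEnd (R := R) M).baseChange R[X]

@[simp] theorem tensorDiff_tmul (p : R[X]) (m : M) :
    tensorDiff M (p ⊗ₜ[R] m) = (X * p) ⊗ₜ[R] m - p ⊗ₜ[R] ((X : R[X]) • m) := by
  simp [tensorDiff, TensorProduct.smul_tmul']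

/-- The action map `R[X] ⊗ M → M`. -/
noncomputable def tensorAct : R[X] ⊗[R] M →ₗ[R[X]] M :=
  (LinearMap.id : M →ₗ[R] M).liftBaseChange R[X]

@[simp] theorem tensorAct_tmul (p : R[X]) (m : M) : tensorAct M (p ⊗ₜ[R] m) = p • m := by
  simp [tensorAct]

/-- The contracting homotopy of the complex given by `tensorDiff` and `tensorAct`. -/
noncomputable def tensorHomotopy : R[X] ⊗[R] M →ₗ[R] R[X] ⊗[R] M :=
  TensorProduct.lift ((Polynomial.basisMonomials R).constr ℕ fun n =>
    ∑ i ∈ Finset.range n, (TensorProduct.mk R R[X] M (X ^ i)) ∘ₗ (xEnd (R := R) M) ^ (n - 1 - i))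

/-- The homotopy is the divided difference `(Xⁿ ⊗ 1 - 1 ⊗ Xⁿ) / (X ⊗ 1 - 1 ⊗ X)`, so both homotopy
identities telescope. For `n = 0` the sum is empty, and the truncated `n - 1` plays no role. -/
theorem tensorHomotopy_X_pow_tmul (n : ℕ) (m : M) :
    tensorHomotopy M ((X ^ n : R[X]) ⊗ₜ[R] m) =
      ∑ i ∈ Finset.range n, (X ^ i : R[X]) ⊗ₜ[R] ((X ^ (n - 1 - i) : R[X]) • m) := by
  have hx (k : ℕ) (m : M) : ((xEnd (R := R) M) ^ k) m = (X ^ k : R[X]) • m := by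
    induction k generalizing m with
    | zero => simp
    | succ k ih => rw [pow_succ', Module.End.mul_apply, ih, xEnd_apply, smul_smul, pow_succ']
  have h : (X ^ n : R[X]) = Polynomial.basisMonomials R n := by
    simp [Polynomial.X_pow_eq_monomial]
  rw [tensorHomotopy, TensorProduct.lift.tmul, h, Module.Basis.constr_basis]
  simp [hx, LinearMap.sum_apply]

omit [Module R[X] M] [IsScalarTower R R[X] M] in
theorem tensor_ext {N : Type*} [AddCommGroup N] [Module R N] {f g : R[X] ⊗[R] M →ₗ[R] N}
    (h : ∀ n m, f ((X ^ n : R[X]) ⊗ₜ[R] m) = g ((X ^ n : R[X]) ⊗ₜ[R] m)) : f = g := by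
  refine TensorProduct.ext (Module.Basis.ext (Polynomial.basisMonomials R) fun n => ?_)
  ext m
  simpa [Polynomial.X_pow_eq_monomial] using h n m

theorem tensorHomotopy_tensorDiff (t : R[X] ⊗[R] M) : tensorHomotopy M (tensorDiff M t) = t := by
  suffices h : tensorHomotopy M ∘ₗ (tensorDiff M).restrictScalars R = LinearMap.id from
    LinearMap.congr_fun h t
  refine tensor_ext M fun n m => ?_
  rw [LinearMap.comp_apply, LinearMap.restrictScalars_apply, tensorDiff_tmul, map_sub,
    ← pow_succ', tensorHomotopy_X_pow_tmul, tensorHomotopy_X_pow_tmul, Finset.sum_range_succ,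
    add_sub_right_comm, ← Finset.sum_sub_distrib, Finset.sum_eq_zero]
  · simp
  · intro i hi
    have : n + 1 - 1 - i = (n - 1 - i) + 1 := by have := Finset.mem_range.1 hi; omega
    rw [this, smul_smul, ← pow_succ, sub_self]

theorem tensorDiff_tensorHomotopy (t : R[X] ⊗[R] M) :
    tensorDiff M (tensorHomotopy M t) = t - 1 ⊗ₜ[R] tensorAct M t := by
  suffices h : (tensorDiff M).restrictScalars R ∘ₗ tensorHomotopy M =
      LinearMap.id - TensorProduct.mk R R[X] M 1 ∘ₗ (tensorAct M).restrictScalars R from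
    LinearMap.congr_fun h t
  refine tensor_ext M fun n m => ?_
  simp only [LinearMap.comp_apply, LinearMap.restrictScalars_apply, tensorHomotopy_X_pow_tmul,
    map_sum, tensorDiff_tmul, LinearMap.sub_apply, LinearMap.id_apply, tensorAct_tmul,
    TensorProduct.mk_apply]
  rw [Finset.sum_congr rfl, Finset.sum_range_sub fun i =>
    (X ^ i : R[X]) ⊗ₜ[R] ((X ^ (n - i) : R[X]) • m)]
  · simp
  · intro i hi
    have h₁ : n - (i + 1) = n - 1 - i := by omega
    have h₂ : n - i = n - 1 - i + 1 := by have := Finset.mem_range.1 hi; omega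
    rw [h₁, h₂, smul_smul, pow_succ', pow_succ']

/-- The sequence `0 → R[X] ⊗ N → R[X] ⊗ N → N → 0` given by `tensorDiff` and `tensorAct` is exact.
Its first two terms are flat base changes of `N` viewed over `R`, which costs no dimension; the
cokernel costs one. -/
theorem hasProjectiveDimensionLE_succ (n : ℕ)
    (h : ∀ N : ModuleCat.{u} R, HasProjectiveDimensionLE N n) (N : ModuleCat.{u} R[X]) :
    HasProjectiveDimensionLE N (n + 1) := by
  let : Module R N := Module.compHom N (algebraMap R R[X])
  have : IsScalarTower R R[X] N := ⟨fun r p m => by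
    rw [Algebra.smul_def, mul_smul]; rfl⟩
  have hT := ModuleCat.shortExact_of_linearMap (tensorDiff (R := R) N) (tensorAct N)
    (Function.LeftInverse.injective (tensorHomotopy_tensorDiff N))
    (fun t => ⟨fun ht => ⟨tensorHomotopy N t, by simp [tensorDiff_tensorHomotopy, ht]⟩, by
      rintro ⟨s, rfl⟩
      induction s using TensorProduct.induction_on with
      | zero => simp
      | tmul p m =>
        rw [tensorDiff_tmul, map_sub, tensorAct_tmul, tensorAct_tmul, mul_comm, mul_smul, sub_self]
      | add s t hs ht => rw [map_add, map_add, hs, ht, add_zero]⟩)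
    (fun m => ⟨1 ⊗ₜ m, by simp⟩)
  have := hasProjectiveDimensionLE_baseChange (R := R) (S := R[X]) n N (h (ModuleCat.of R N))
  have h₂ : HasProjectiveDimensionLT (ModuleCat.of R[X] (R[X] ⊗[R] N)) (n + 1 + 1) :=
    hasProjectiveDimensionLT_of_ge _ (n + 1) (n + 2) (by omega)
  exact hT.hasProjectiveDimensionLT_X₃ (n + 1) this h₂

end Polynomial

attribute [local instance] RingHomInvPair.of_ringEquiv in
theorem hasProjectiveDimensionLE_of_ringEquiv {R S : Type u} [CommRing R] [CommRing S]
    (e : R ≃+* S) (n : ℕ) (h : ∀ N : ModuleCat.{u} R, HasProjectiveDimensionLE N n)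
    (N : ModuleCat.{u} S) : HasProjectiveDimensionLE N n := by
  let : Module R N := Module.compHom N e.toRingHom
  let e' : ModuleCat.of R N ≃ₛₗ[RingHomClass.toRingHom e] N :=
    { AddEquiv.refl N with map_smul' := fun r m => rfl }
  have := h (ModuleCat.of R N)
  exact ModuleCat.hasProjectiveDimensionLE_of_semiLinearEquiv e e' n

/-- A weak form of Hilbert's syzygy theorem. -/
theorem MvPolynomial.exists_hasProjectiveDimensionLE (K : Type u) [Field K] (σ : Type) [Finite σ] :
    ∃ n, ∀ N : ModuleCat.{u} (MvPolynomial σ K), HasProjectiveDimensionLE N n := by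
  induction σ using Finite.induction_empty_option with
  | of_equiv e ih =>
    obtain ⟨n, h⟩ := ih
    exact ⟨n, hasProjectiveDimensionLE_of_ringEquiv (MvPolynomial.renameEquiv K e).toRingEquiv n h⟩
  | h_empty =>
    refine ⟨0, hasProjectiveDimensionLE_of_ringEquiv
      (MvPolynomial.isEmptyRingEquiv K PEmpty).symm 0 fun N => ?_⟩
    rw [HasProjectiveDimensionLE, zero_add, ← projective_iff_hasProjectiveDimensionLT_one,
      ← IsProjective.iff_projective]
    exact Module.Projective.of_free (R := K) (P := N)
  | h_option ih =>
    obtain ⟨n, h⟩ := ih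
    exact ⟨n + 1, hasProjectiveDimensionLE_of_ringEquiv
      (MvPolynomial.optionEquivLeft K _).symm.toRingEquiv (n + 1)
      (Polynomial.hasProjectiveDimensionLE_succ n h)⟩

theorem MvPolynomial.exists_hasInjectiveDimensionLE (K : Type u) [Field K] (σ : Type) [Finite σ] :
    ∃ n, HasInjectiveDimensionLE
      (ModuleCat.of (MvPolynomial σ K) (MvPolynomial σ K)) n := by
  obtain ⟨n, h⟩ := MvPolynomial.exists_hasProjectiveDimensionLE K σ
  refine ⟨n, HasInjectiveDimensionLT.mk fun i hi Y e => ?_⟩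
  have := h Y
  exact e.eq_zero_of_hasProjectiveDimensionLT (n + 1) hi

end Syzygy

/-! ### Prime ideals and prime elements of `A` -/

namespace QuadricHypersurface

open MvPolynomial

section Primes

variable (K : Type u) [Field K]

variable {K} in
theorem toA_surjective : Function.Surjective (toA K) := Ideal.Quotient.mk_surjective

/-- The canonical map from the polynomial ring to `A`. -/
noncomputable def polyToA : Poly K →+* A K := (toA K).comp (algebraMap (Poly K) (LocPoly K))

@[simp] theorem polyToA_X (i : Fin 3 ⊕ Fin 3) : polyToA K (X i) = coord K i := rfl

theorem polyToA_quadric : polyToA K (quadric K) = 0 :=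
  Ideal.Quotient.eq_zero_iff_mem.2 (Ideal.subset_span rfl)

theorem relation : u K * x K + v K * y K + w K * z K = 0 := by
  have := polyToA_quadric K
  simp only [quadric, map_add, map_mul, polyToA_X] at this
  exact this

theorem isUnit_polyToA {s : Poly K} (hs : s ∉ maxIdeal K) : IsUnit (polyToA K s) :=
  (IsLocalization.map_units (LocPoly K) (⟨s, hs⟩ : (maxIdeal K).primeCompl)).map (toA K)

theorem exists_polyToA_mul_eq (f : A K) :
    ∃ s ∉ maxIdeal K, ∃ p, polyToA K s * f = polyToA K p := by
  obtain ⟨g, rfl⟩ := toA_surjective f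
  obtain ⟨⟨p, s⟩, h⟩ := IsLocalization.surj (maxIdeal K).primeCompl g
  refine ⟨s, s.2, p, ?_⟩
  rw [mul_comm]
  exact ((toA K).map_mul _ _).symm.trans (congrArg (toA K) h)

variable {K}

theorem map_polyToA (J : Ideal (Poly K)) :
    J.map (polyToA K) = (J.map (algebraMap (Poly K) (LocPoly K))).map (toA K) :=
  (Ideal.map_map _ _).symm

theorem disjoint_primeCompl {J : Ideal (Poly K)} (hJ : J ≤ maxIdeal K) :
    Disjoint ((maxIdeal K).primeCompl : Set (Poly K)) J :=
  Set.disjoint_left.2 fun _ hs hs' => hs (hJ hs')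

theorem ker_toA_le {J : Ideal (Poly K)} (hq : quadric K ∈ J) :
    RingHom.ker (toA K) ≤ J.map (algebraMap (Poly K) (LocPoly K)) := by
  have h : RingHom.ker (toA K) = quadricIdeal K := Ideal.mk_ker
  rw [h, Ideal.span_singleton_le_iff_mem]
  exact Ideal.mem_map_of_mem _ hq

theorem isPrime_map_polyToA (J : Ideal (Poly K)) [hp : J.IsPrime] (hq : quadric K ∈ J)
    (hJ : J ≤ maxIdeal K) : (J.map (polyToA K)).IsPrime := by
  have h := IsLocalization.isPrime_of_isPrime_disjoint (maxIdeal K).primeCompl (LocPoly K) J hp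
    (disjoint_primeCompl hJ)
  rw [map_polyToA]
  exact Ideal.map_isPrime_of_surjective toA_surjective (ker_toA_le hq)

/-- A prime inside the maximal ideal survives localization and contracts back to itself; containing
the quadric, it also survives the quotient. Membership questions in `A` thus become questions about
polynomials. -/
theorem polyToA_mem_map_iff (J : Ideal (Poly K)) [hp : J.IsPrime] (hq : quadric K ∈ J)
    (hJ : J ≤ maxIdeal K) (p : Poly K) : polyToA K p ∈ J.map (polyToA K) ↔ p ∈ J := by
  refine ⟨fun h => ?_, Ideal.mem_map_of_mem _⟩
  rw [map_polyToA, polyToA, RingHom.comp_apply] at h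
  rw [← IsLocalization.under_map_of_isPrime_disjoint (maxIdeal K).primeCompl (LocPoly K) hp
    (disjoint_primeCompl hJ), Ideal.mem_comap]
  have h' := Ideal.mem_comap.2 h
  rwa [Ideal.comap_map_of_surjective _ toA_surjective, ← RingHom.ker_eq_comap_bot,
    sup_eq_left.2 (ker_toA_le hq)] at h'

theorem polyToA_eq_zero_iff (p : Poly K) : polyToA K p = 0 ↔ quadric K ∣ p := by
  have hp : (Ideal.span {quadric K} : Ideal (Poly K)).IsPrime :=
    (Ideal.span_singleton_prime (quadric_irreducible K).ne_zero).2 (quadric_irreducible K).prime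
  have h := polyToA_mem_map_iff (Ideal.span {quadric K}) (Ideal.subset_span rfl)
    ((Ideal.span_singleton_le_iff_mem _).2 (quadric_mem K)) p
  rwa [Ideal.map_span, Set.image_singleton, polyToA_quadric, Ideal.mem_span_singleton,
    Ideal.mem_span_singleton, zero_dvd_iff] at h

/-- Setting the variables in `s` equal to zero. -/
noncomputable def killVars (s : Set (Fin 3 ⊕ Fin 3)) [DecidablePred (· ∈ s)] :
    Poly K →ₐ[K] Poly K := aeval fun i => if i ∈ s then 0 else X i

theorem sub_killVars_mem (s : Set (Fin 3 ⊕ Fin 3)) [DecidablePred (· ∈ s)] (p : Poly K) :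
    p - killVars s p ∈ Ideal.span (X '' s : Set (Poly K)) := by
  induction p using MvPolynomial.induction_on with
  | C a => simp [killVars]
  | add p q hp hq => rw [map_add, add_sub_add_comm]; exact Ideal.add_mem _ hp hq
  | mul_X p i hp =>
    have : p * X i - killVars s (p * X i) =
        (p - killVars s p) * X i + killVars s p * (X i - killVars s (X i)) := by
      rw [map_mul]; ring
    rw [this]
    refine Ideal.add_mem _ (Ideal.mul_mem_right _ _ hp) (Ideal.mul_mem_left _ _ ?_)
    by_cases hi : i ∈ s
    · have : (X i : Poly K) ∈ Ideal.span (X '' s) := Ideal.subset_span ⟨i, hi, rfl⟩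
      simpa [killVars, hi] using this
    · simp [killVars, hi]

theorem killVars_X_of_mem {s : Set (Fin 3 ⊕ Fin 3)} [DecidablePred (· ∈ s)] {i : Fin 3 ⊕ Fin 3}
    (hi : i ∈ s) : killVars s (X i : Poly K) = 0 := by simp [killVars, hi]

theorem killVars_X_of_notMem {s : Set (Fin 3 ⊕ Fin 3)} [DecidablePred (· ∈ s)]
    {i : Fin 3 ⊕ Fin 3} (hi : i ∉ s) : killVars s (X i : Poly K) = X i := by simp [killVars, hi]

theorem ker_killVars (s : Set (Fin 3 ⊕ Fin 3)) [DecidablePred (· ∈ s)] :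
    RingHom.ker (killVars (K := K) s) = Ideal.span (X '' s) := by
  refine le_antisymm (fun p hp => ?_) (Ideal.span_le.2 ?_)
  · have := sub_killVars_mem s p
    rwa [RingHom.mem_ker.1 hp, sub_zero] at this
  · rintro _ ⟨i, hi, rfl⟩
    exact killVars_X_of_mem hi

instance isPrime_span_X_image (s : Set (Fin 3 ⊕ Fin 3)) :
    (Ideal.span (X '' s) : Ideal (Poly K)).IsPrime := by
  classical
  rw [← ker_killVars]
  exact RingHom.ker_isPrime _

theorem span_X_image_le (s : Set (Fin 3 ⊕ Fin 3)) :
    (Ideal.span (X '' s) : Ideal (Poly K)) ≤ maxIdeal K :=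
  Ideal.span_mono (Set.image_subset_range _ _)

/-- The ideal generated by the quadric and a variable. -/
noncomputable def quadricSup (i : Fin 3 ⊕ Fin 3) : Ideal (Poly K) := Ideal.span {quadric K, X i}

theorem quadricSup_le (i : Fin 3 ⊕ Fin 3) : quadricSup (K := K) i ≤ maxIdeal K := by
  refine Ideal.span_le.2 ?_
  rintro _ (rfl | rfl)
  · exact quadric_mem K
  · exact Ideal.subset_span ⟨i, rfl⟩

/-- Every polynomial is congruent modulo `X i` to its image under `killVars {i}`, so only
divisibility by the truncated quadric remains. -/
theorem mem_quadricSup_iff (i : Fin 3 ⊕ Fin 3) (p : Poly K) :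
    p ∈ quadricSup i ↔ killVars {i} (quadric K) ∣ killVars {i} p := by
  have hX : Ideal.span (X '' {i}) ≤ quadricSup (K := K) i := Ideal.span_mono (by simp)
  constructor
  · intro h
    obtain ⟨f, g, rfl⟩ := Ideal.mem_span_pair.1 h
    rw [map_add, map_mul, map_mul, killVars_X_of_mem (Set.mem_singleton i), mul_zero, add_zero]
    exact dvd_mul_left _ _
  · rintro ⟨f, hf⟩
    have h₁ := hX (sub_killVars_mem {i} p)
    have h₂ := hX (sub_killVars_mem {i} (quadric K))
    have hq : quadric K ∈ quadricSup i := Ideal.subset_span (by simp)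
    have h₃ := sub_sub_cancel (quadric K) (killVars {i} (quadric K)) ▸ Ideal.sub_mem _ hq h₂
    rw [← sub_add_cancel p (killVars {i} p), hf]
    exact Ideal.add_mem _ (hf ▸ h₁) (Ideal.mul_mem_right _ _ h₃)

theorem prime_killVars_quadric (i : Fin 3 ⊕ Fin 3) :
    Prime (killVars {i} (quadric K)) := by
  let k : Fin 3 := Sum.elim id id i
  have h := irreducible_sumSMulXSMulY (n := Fin 3) (R := K)
    (Finsupp.equivFunOnFinite.symm (fun j => if j = k then (0 : K) else 1))
    -- Killing one variable removes the product of pair `k`; the other two products still give a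
    -- nontrivial support, which the irreducibility criterion needs.
    ⟨k + 1, by simp, k + 2, by simp, by simp⟩
    (fun r hr => isUnit_of_dvd_one (by simpa using hr (k + 1)))
  have e : sumSMulXSMulY (Finsupp.equivFunOnFinite.symm (fun j => if j = k then (0 : K) else 1))
      = killVars {i} (quadric K) := by
    rw [sumSMulXSMulY, Finsupp.linearCombination_apply, Finsupp.sum_fintype _ _ (by simp)]
    rcases i with i | i <;> fin_cases i <;> simp [Fin.sum_univ_three, quadric, killVars, k]
  rw [e] at h
  exact h.prime

instance isPrime_quadricSup (i : Fin 3 ⊕ Fin 3) : (quadricSup (K := K) i).IsPrime := by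
  have hp : (Ideal.span {killVars {i} (quadric K)}).IsPrime :=
    (Ideal.span_singleton_prime (prime_killVars_quadric i).ne_zero).2 (prime_killVars_quadric i)
  have : quadricSup (K := K) i = (Ideal.span {killVars {i} (quadric K)}).comap (killVars {i}) := by
    ext p
    rw [mem_quadricSup_iff, Ideal.mem_comap, Ideal.mem_span_singleton]
  rw [this]
  exact Ideal.IsPrime.comap _

theorem map_quadricSup (i : Fin 3 ⊕ Fin 3) :
    (quadricSup i).map (polyToA K) = Ideal.span {coord K i} := by
  rw [quadricSup, Ideal.map_span, Set.image_pair, polyToA_quadric, polyToA_X,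
    Ideal.span_insert_zero]

theorem quadric_mem_quadricSup (i : Fin 3 ⊕ Fin 3) : quadric K ∈ quadricSup i :=
  Ideal.subset_span (by simp)

theorem eval_quadric_eq_zero {f : Fin 3 ⊕ Fin 3 → K}
    (hf : ∀ k, f (Sum.inl k) * f (Sum.inr k) = 0) : eval f (quadric K) = 0 := by
  simp [quadric, hf]

theorem single_inl_mul_single_inr (i : Fin 3 ⊕ Fin 3) (k : Fin 3) :
    Pi.single (M := fun _ => K) i 1 (Sum.inl k) * Pi.single (M := fun _ => K) i 1 (Sum.inr k) = 0 := by
  rcases i with i | i <;> simp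

theorem coord_ne_zero (i : Fin 3 ⊕ Fin 3) : coord K i ≠ 0 := by
  intro h
  rw [← polyToA_X, polyToA_eq_zero_iff] at h
  have := map_dvd (eval (Pi.single i 1)) h
  rw [eval_quadric_eq_zero (single_inl_mul_single_inr i)] at this
  simp at this

theorem prime_coord (i : Fin 3 ⊕ Fin 3) : Prime (coord K i) := by
  rw [← Ideal.span_singleton_prime (coord_ne_zero i), ← map_quadricSup]
  exact isPrime_map_polyToA _ (quadric_mem_quadricSup i) (quadricSup_le i)

/-- At the `j`-th unit vector the quadric with variable `i` killed vanishes, whereas `X j` takes the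
value 1. -/
theorem not_coord_dvd_coord {i j : Fin 3 ⊕ Fin 3} (h : i ≠ j) : ¬ coord K i ∣ coord K j := by
  rw [← Ideal.mem_span_singleton, ← map_quadricSup, ← polyToA_X K j,
    polyToA_mem_map_iff _ (quadric_mem_quadricSup i) (quadricSup_le i), mem_quadricSup_iff,
    killVars_X_of_notMem (by simpa using h.symm)]
  intro hd
  have := map_dvd (eval (Pi.single j 1)) hd
  have e : eval (Pi.single j 1) (killVars {i} (quadric K)) =
      eval (fun l => if l ∈ ({i} : Set _) then 0 else Pi.single (M := fun _ => K) j 1 l) (quadric K) := by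
    suffices h : (eval (Pi.single j 1)).comp (killVars (K := K) {i}).toRingHom = eval fun l =>
        if l ∈ ({i} : Set _) then 0 else Pi.single (M := fun _ => K) j 1 l from
      RingHom.congr_fun h _
    refine MvPolynomial.ringHom_ext (fun a => by simp [killVars]) fun l => ?_
    by_cases hl : l = i <;> simp [killVars, hl]
  rw [e, eval_quadric_eq_zero] at this
  · simp at this
  · intro k
    split_ifs <;> simp [single_inl_mul_single_inr]

theorem P_eq_map : P K = (Ideal.span (X '' (Set.range Sum.inl))).map (polyToA K) := by
  rw [Ideal.map_span, P]
  congr 1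
  ext f
  simp [Fin.exists_fin_succ, u, v, w, eq_comm]

theorem isPrime_P : (P K).IsPrime := by
  rw [P_eq_map]
  refine isPrime_map_polyToA _ ?_ (span_X_image_le _)
  have h (k : Fin 3) : (X (Sum.inl k) : Poly K) ∈ Ideal.span (X '' Set.range Sum.inl) :=
    Ideal.subset_span ⟨_, ⟨k, rfl⟩, rfl⟩
  exact Ideal.add_mem _ (Ideal.add_mem _ (Ideal.mul_mem_right _ _ (h _))
    (Ideal.mul_mem_right _ _ (h _))) (Ideal.mul_mem_right _ _ (h _))

end Primes

end QuadricHypersurface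

/-! ### Nagata's criterion for normality -/

section Nagata

/-- Multiplying an integral equation of degree `n` for `f` by `sⁿ` gives a monic equation for `r = s
f` whose lower coefficients are all divisible by `s`; hence `p ∣ rⁿ`. -/
theorem Prime.dvd_of_mul_eq_algebraMap_of_isIntegral {A L : Type*} [CommRing A] [IsDomain A]
    [Field L] [Algebra A L] [FaithfulSMul A L] {p : A} (hp : Prime p) {f : L} (hf : IsIntegral A f)
    {s r : A} (hs : p ∣ s) (h : algebraMap A L s * f = algebraMap A L r) : p ∣ r := by
  obtain ⟨q, hq, hq0⟩ := hf
  have h₁ : (q.scaleRoots s).eval r = 0 := by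
    have := Polynomial.scaleRoots_eval₂_eq_zero (algebraMap A L) (s := s) hq0
    rw [h, Polynomial.eval₂_at_apply] at this
    exact (FaithfulSMul.algebraMap_injective A L) (by rw [this, map_zero])
  have h₂ := Polynomial.dvd_term_of_isRoot_of_dvd_terms (p := p) (r := r) q.natDegree h₁ ?_
  · rw [Polynomial.coeff_scaleRoots_natDegree, hq.leadingCoeff, one_mul] at h₂
    exact hp.dvd_of_dvd_pow h₂
  · intro j hj
    rcases lt_or_gt_of_ne hj with hj | hj
    · rw [Polynomial.coeff_scaleRoots]
      exact Dvd.dvd.mul_right (Dvd.dvd.mul_left (dvd_pow hs (by omega)) _) _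
    · rw [Polynomial.coeff_scaleRoots, Polynomial.coeff_eq_zero_of_natDegree_lt hj]
      simp

theorem IsIntegrallyClosed.of_prime_of_localizationAway {A : Type*} [CommRing A] [IsDomain A]
    {p : A} (hp : Prime p) [IsIntegrallyClosed (Localization.Away p)] : IsIntegrallyClosed A := by
  have hle : Submonoid.powers p ≤ nonZeroDivisors A :=
    powers_le_nonZeroDivisors_of_noZeroDivisors hp.ne_zero
  let := IsLocalization.localizationAlgebraOfSubmonoidLe (Localization.Away p) (FractionRing A)
    (Submonoid.powers p) (nonZeroDivisors A) hle
  have := IsLocalization.localization_isScalarTower_of_submonoid_le (Localization.Away p)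
    (FractionRing A) (Submonoid.powers p) (nonZeroDivisors A) hle
  have := IsFractionRing.isFractionRing_of_isLocalization (Submonoid.powers p)
    (Localization.Away p) (FractionRing A) hle
  refine (isIntegrallyClosed_iff (FractionRing A)).2 fun {f} hf => ?_
  obtain ⟨g, rfl⟩ := (isIntegrallyClosed_iff (FractionRing A)).1
    ‹IsIntegrallyClosed (Localization.Away p)› (hf.tower_top (A := Localization.Away p))
  obtain ⟨⟨r, ⟨_, n, rfl⟩⟩, hr⟩ := IsLocalization.surj (Submonoid.powers p) g
  replace hr := congrArg (algebraMap _ (FractionRing A)) hr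
  rw [map_mul, ← IsScalarTower.algebraMap_apply, ← IsScalarTower.algebraMap_apply, mul_comm] at hr
  generalize algebraMap _ (FractionRing A) g = f at hf hr
  dsimp only at hr
  -- Here `pⁿ f = r` with `f` integral over `A`; the preceding lemma cancels the factors `p` one at
  -- a time.
  induction n generalizing r with
  | zero => exact ⟨r, by simpa using hr.symm⟩
  | succ n ih =>
    obtain ⟨r', rfl⟩ := hp.dvd_of_mul_eq_algebraMap_of_isIntegral hf (dvd_pow_self p n.succ_ne_zero)
      hr
    refine ih r' (mul_left_cancel₀ (a := algebraMap A (FractionRing A) p) ?_ ?_)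
    · simpa using hp.ne_zero
    · rw [← mul_assoc, ← map_mul, ← pow_succ', hr, map_mul]

end Nagata

/-! ### Normality of `A` -/

namespace QuadricHypersurface

open MvPolynomial

section Normal

variable (K : Type u) [Field K]

/-- The indices of the variables other than `X`. -/
abbrev FreeIndex : Type := {i : Fin 3 ⊕ Fin 3 // i ≠ Sum.inr 0}

/-- The polynomial ring `K[U, V, W, Y, Z]`. -/
abbrev FreePoly : Type u := MvPolynomial FreeIndex K

/-- The map from `K[U, V, W, Y, Z]` to `A`. -/
noncomputable def freeToA : FreePoly K →+* A K :=
  (polyToA K).comp (rename (R := K) Subtype.val : FreePoly K →ₐ[K] Poly K).toRingHom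

variable {K}

theorem freeToA_X (i : FreeIndex) : freeToA K (X i) = coord K i := by
  simp [freeToA]

/-- The substitution `X ↦ -(VY + WZ)/U` into the fraction field of `K[U, V, W, Y, Z]` kills the
quadric and fixes the other variables. -/
theorem freeToA_injective : Function.Injective (freeToA K) := by
  rw [injective_iff_map_eq_zero]
  intro p hp
  let F := FractionRing (FreePoly K)
  let ι : FreeIndex → F := fun i => algebraMap (FreePoly K) F (X i)
  let U : F := ι ⟨Sum.inl 0, by simp⟩
  let V : F := ι ⟨Sum.inl 1, by simp⟩
  let W : F := ι ⟨Sum.inl 2, by simp⟩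
  let Y : F := ι ⟨Sum.inr 1, by simp⟩
  let Z : F := ι ⟨Sum.inr 2, by simp⟩
  have hU : U ≠ 0 := by simp [U, ι]
  let θ : Poly K →ₐ[K] F := aeval fun i => if h : i ≠ Sum.inr 0 then ι ⟨i, h⟩ else
    - (V * Y + W * Z) / U
  have hq : θ (quadric K) = 0 := by
    simp only [quadric, map_add, map_mul, θ, aeval_X]
    simp
    change U * (_ / U) + V * Y + W * Z = 0
    rw [← mul_div_assoc, mul_div_cancel_left₀ _ hU]
    ring
  have hθ : (θ.comp (rename Subtype.val)) = (IsScalarTower.toAlgHom K (FreePoly K) F) := by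
    refine MvPolynomial.algHom_ext fun i => ?_
    simp [θ, i.2, ι]
  have h₁ := map_dvd θ ((polyToA_eq_zero_iff _).1 hp)
  rw [hq, zero_dvd_iff] at h₁
  have h₂ := AlgHom.congr_fun hθ p
  rw [AlgHom.comp_apply] at h₂
  exact (IsFractionRing.injective (FreePoly K) F) (by rw [map_zero]; exact h₂.symm.trans h₁)

/-- The polynomials in `U, V, W, Y, Z` that become units in `A[1/u]`. -/
noncomputable def freeUnits (K : Type u) [Field K] : Submonoid (FreePoly K) :=
  (IsUnit.submonoid (Localization.Away (u K))).comap
    ((algebraMap (A K) (Localization.Away (u K))).comp (freeToA K))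

noncomputable instance : Algebra (FreePoly K) (Localization.Away (u K)) :=
  ((algebraMap (A K) (Localization.Away (u K))).comp (freeToA K)).toAlgebra

/-- Each occurrence of `x` is eliminated at the cost of one factor `u`, by `u x = -(v y + w z)`. -/
theorem exists_u_pow_mul_polyToA (p : Poly K) : ∃ n q, u K ^ n * polyToA K p = freeToA K q := by
  induction p using MvPolynomial.induction_on with
  | C a => exact ⟨0, C a, by simp [freeToA]⟩
  | add p q hp hq =>
    obtain ⟨n, p', hp⟩ := hp
    obtain ⟨m, q', hq⟩ := hq
    have hu : freeToA K (X ⟨Sum.inl 0, by simp⟩) = u K := freeToA_X _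
    refine ⟨n + m, X ⟨Sum.inl 0, by simp⟩ ^ m * p' + X ⟨Sum.inl 0, by simp⟩ ^ n * q', ?_⟩
    simp only [map_add, map_mul, map_pow, ← hp, ← hq, hu]
    ring
  | mul_X p i hp =>
    obtain ⟨n, p', hp⟩ := hp
    by_cases hi : i = Sum.inr 0
    · refine ⟨n + 1, - p' * (X ⟨Sum.inl 1, by simp⟩ * X ⟨Sum.inr 1, by simp⟩ +
        X ⟨Sum.inl 2, by simp⟩ * X ⟨Sum.inr 2, by simp⟩), ?_⟩
      subst hi
      simp only [map_add, map_mul, map_neg, freeToA_X, polyToA_X, ← hp]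
      change _ * (_ * x K) = - _ * (v K * y K + w K * z K)
      linear_combination u K ^ n * polyToA K p * relation K
    · refine ⟨n, p' * X ⟨i, hi⟩, ?_⟩
      rw [map_mul, map_mul, freeToA_X, polyToA_X, ← hp, mul_assoc]

theorem powers_u_le : Submonoid.powers (u K) ≤ nonZeroDivisors (A K) :=
  powers_le_nonZeroDivisors_of_noZeroDivisors (coord_ne_zero (Sum.inl 0))

theorem algebraMap_away_u_injective :
    Function.Injective (algebraMap (A K) (Localization.Away (u K))) :=
  IsLocalization.injective _ powers_u_le

instance : IsLocalization (freeUnits K) (Localization.Away (u K)) where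
  map_units s := s.2
  surj g := by
    have huu : IsUnit (algebraMap (A K) (Localization.Away (u K)) (u K)) :=
      IsLocalization.Away.algebraMap_isUnit _
    obtain ⟨⟨a, ⟨_, n, rfl⟩⟩, ha⟩ := IsLocalization.surj (Submonoid.powers (u K)) g
    obtain ⟨s, hs, p, hp⟩ := exists_polyToA_mul_eq K a
    obtain ⟨i, s', hs'⟩ := exists_u_pow_mul_polyToA s
    obtain ⟨j, p', hp'⟩ := exists_u_pow_mul_polyToA p
    let U : FreePoly K := X ⟨Sum.inl 0, by simp⟩
    have hU : freeToA K U = u K := freeToA_X _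
    refine ⟨⟨U ^ i * p', ⟨s' * U ^ (j + n), ?_⟩⟩, ?_⟩
    · change IsUnit (algebraMap (A K) (Localization.Away (u K)) (freeToA K _))
      rw [map_mul, map_pow, hU, ← hs']
      simp only [map_mul, map_pow]
      exact ((huu.pow _).mul ((isUnit_polyToA K hs).map _)).mul (huu.pow _)
    · change g * (algebraMap (A K) (Localization.Away (u K)) (freeToA K _)) =
        algebraMap (A K) (Localization.Away (u K)) (freeToA K _)
      have : freeToA K (U ^ i * p') = freeToA K s' * u K ^ j * a := by
        rw [map_mul, map_pow, hU, ← hp', ← hs', ← hp]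
        ring
      rw [this, map_mul _ _ a, ← ha]
      simp only [map_mul, map_pow, hU, pow_add]
      ring
  exists_of_eq {p q} h := by
    have : p = q := freeToA_injective (algebraMap_away_u_injective h)
    exact ⟨1, by rw [this]⟩

instance : IsIntegrallyClosed (A K) := by
  have hle : freeUnits K ≤ nonZeroDivisors (FreePoly K) := by
    refine le_nonZeroDivisors_of_noZeroDivisors fun h => ?_
    change IsUnit (algebraMap (A K) (Localization.Away (u K)) (freeToA K 0)) at h
    have : Nontrivial (Localization.Away (u K)) := algebraMap_away_u_injective.nontrivial
    simp at h
  have : IsIntegrallyClosed (Localization.Away (u K)) :=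
    isIntegrallyClosed_of_isLocalization _ (freeUnits K) hle
  exact IsIntegrallyClosed.of_prime_of_localizationAway (p := u K) (prime_coord _)

end Normal

end QuadricHypersurface

/-! ### Derivations and linear independence over squares -/

section SquareClasses

theorem Derivation.map_sq_of_charTwo {A : Type*} [CommRing A] [CharP A 2] (D : Derivation ℤ A A)
    (a : A) : D (a ^ 2) = 0 := by
  rw [D.leibniz_pow]
  simp [CharTwo.two_eq_zero]

variable {A L : Type*} [CommRing A] [IsDomain A] [CharP A 2] [Field L] [Algebra A L]
  [IsFractionRing A L]

/-- In characteristic two, derivations are linear over the squares of the fraction field. -/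
theorem Derivation.algebraMap_eq_sum {ι : Type*} [Fintype ι] (D : Derivation ℤ A A) {F : A}
    {c : ι → L} {m : ι → A} (h : algebraMap A L F = ∑ i, c i ^ 2 * algebraMap A L (m i)) :
    algebraMap A L (D F) = ∑ i, c i ^ 2 * algebraMap A L (D (m i)) := by
  -- With a common denominator `s`, the identity `s² F = ∑ nᵢ² mᵢ` holds in `A`, and `D` treats `s²`
  -- and `nᵢ²` as constants.
  obtain ⟨⟨s, hs⟩, hc⟩ := IsLocalization.exist_integer_multiples_of_finite (nonZeroDivisors A) c
  choose n hn using hc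
  have hs0 : algebraMap A L s ≠ 0 := by simpa using nonZeroDivisors.ne_zero hs
  have hn' (i) : algebraMap A L (n i) = algebraMap A L s * c i := by
    rw [hn]; exact Algebra.smul_def _ _
  have h₁ : s ^ 2 * F = ∑ i, n i ^ 2 * m i := by
    apply IsFractionRing.injective A L
    simp only [map_mul, map_sum, map_pow, hn', h, Finset.mul_sum]
    exact Finset.sum_congr rfl fun i _ => by ring
  have h₂ := congrArg D h₁
  simp only [map_sum, Derivation.leibniz, D.map_sq_of_charTwo, smul_eq_mul, mul_zero,
    add_zero] at h₂
  refine mul_left_cancel₀ (pow_ne_zero 2 hs0) ?_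
  have h₃ := congrArg (algebraMap A L) h₂
  simp only [map_mul, map_sum, map_pow, hn'] at h₃
  rw [h₃, Finset.mul_sum]
  exact Finset.sum_congr rfl fun i _ => by ring

omit [CharP A 2] [IsDomain A] in
-- With `h = g r n` and `k = g m` in `A`, one has `h m = r k n`, so `r` divides `h` and can be
-- cancelled.
theorem mem_range_of_mul_prime {r m n : A} (hr : Prime r) (hm : ¬ r ∣ m) {g : L}
    (h₁ : g * algebraMap A L (r * n) ∈ (algebraMap A L).range)
    (h₂ : g * algebraMap A L m ∈ (algebraMap A L).range) :
    g * algebraMap A L n ∈ (algebraMap A L).range := by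
  obtain ⟨h, hh⟩ := h₁
  obtain ⟨k, hk⟩ := h₂
  have h₃ : h * m = r * (k * n) := by
    apply IsFractionRing.injective A L
    rw [map_mul, hh, map_mul, map_mul, map_mul, hk]
    ring
  obtain ⟨h', rfl⟩ := (hr.dvd_or_dvd (Dvd.intro _ h₃.symm)).resolve_right hm
  refine ⟨h', mul_left_cancel₀ (a := algebraMap A L r) (by simpa using hr.ne_zero) ?_⟩
  rw [← map_mul, hh, map_mul]
  ring

omit [CharP A 2] [IsDomain A] in
theorem mem_range_of_sq_mem_range [IsIntegrallyClosed A] {g : L}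
    (h : g ^ 2 ∈ (algebraMap A L).range) : g ∈ (algebraMap A L).range := by
  obtain ⟨k, hk⟩ := h
  exact IsIntegrallyClosed.exists_algebraMap_eq_of_isIntegral_pow two_pos
    (hk ▸ isIntegral_algebraMap)

variable [IsIntegrallyClosed A] {t : Fin 4 → A} {z : A} {D : Fin 4 → Derivation ℤ A A}

/-- If a square-linear combination of `1, p, q, p * q` lies in `A`, where `p = t 0 * t 3 * z` and
`q = t 1 * t 2 * z`, then `z ^ 3` clears the denominators of the coefficients. -/
theorem pow_three_mul_mem_range (ht : ∀ i, Prime (t i)) (htt : ∀ i j, i ≠ j → ¬ t i ∣ t j)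
    (hD : ∀ i j, D i (t j) = if i = j then z else 0) (hz : ∀ i, D i z = 0)
    {c : Fin 4 → L} {F : A} (h : algebraMap A L F = ∑ i, c i ^ 2 * algebraMap A L
      ((![1, t 0 * t 3 * z, t 1 * t 2 * z, (t 0 * t 3 * z) * (t 1 * t 2 * z)] : Fin 4 → A) i))
    (i : Fin 4) : algebraMap A L z ^ 3 * c i ∈ (algebraMap A L).range := by
  -- Only the `p * q` term survives two derivations that hit different factors: these give `(z² c₃)²
  -- t₀ t₂` and `(z² c₃)² t₁ t₃`. The primes `t₀`, `t₂` do not divide `t₁ t₃`, so they can be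
  -- removed.
  have e₁ := (D 3).algebraMap_eq_sum ((D 1).algebraMap_eq_sum h)
  have e₂ := (D 2).algebraMap_eq_sum ((D 0).algebraMap_eq_sum h)
  simp [Fin.sum_univ_four, hD, hz] at e₁ e₂
  have hmul {i j k : Fin 4} (hij : i ≠ j) (hik : i ≠ k) : ¬ t i ∣ t j * t k := fun h' =>
    ((ht i).dvd_or_dvd h').elim (htt i j hij) (htt i k hik)
  obtain ⟨n, hn⟩ : algebraMap A L z ^ 2 * c 3 ∈ (algebraMap A L).range := by
    refine mem_range_of_sq_mem_range ?_
    have h₁ := mem_range_of_mul_prime (A := A) (g := (algebraMap A L z ^ 2 * c 3) ^ 2) (ht 0)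
      (m := t 1 * t 3) (n := t 2 * 1) (hmul (by simp) (by simp))
      ⟨_, e₁.trans (by simp only [map_mul, map_one]; ring)⟩
      ⟨_, e₂.trans (by simp only [map_mul]; ring)⟩
    have h₂ := mem_range_of_mul_prime (A := A) (ht 2) (m := t 1 * t 3)
      (hmul (by simp) (by simp)) h₁
      ⟨_, e₂.trans (by simp only [map_mul]; ring)⟩
    simpa using h₂
  -- Once its `p * q` term is known to lie in `A`, subtracting it from `z⁴ F` leaves an element on
  -- which one derivation isolates `c₁` or `c₂`, bringing a further `z²` under the square.
  obtain ⟨G, hG⟩ : ∃ G, algebraMap A L G =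
      ∑ i, (![algebraMap A L z ^ 2 * c 0, algebraMap A L z ^ 2 * c 1, algebraMap A L z ^ 2 * c 2, 0]
        : Fin 4 → L) i ^ 2 * algebraMap A L
      ((![1, t 0 * t 3 * z, t 1 * t 2 * z, (t 0 * t 3 * z) * (t 1 * t 2 * z)] : Fin 4 → A) i) := by
    refine ⟨z ^ 4 * F - n ^ 2 * ((t 0 * t 3 * z) * (t 1 * t 2 * z)), ?_⟩
    rw [map_sub, map_mul, h, map_mul (algebraMap A L) (n ^ 2), map_pow, map_pow, hn]
    simp [Fin.sum_univ_four]
    ring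
  have f₀ := (D 0).algebraMap_eq_sum hG
  have f₁ := (D 1).algebraMap_eq_sum hG
  have f₂ := (D 2).algebraMap_eq_sum hG
  have f₃ := (D 3).algebraMap_eq_sum hG
  simp [Fin.sum_univ_four, hD, hz] at f₀ f₁ f₂ f₃ hG
  have h₁ : algebraMap A L z ^ 3 * c 1 ∈ (algebraMap A L).range := by
    refine mem_range_of_sq_mem_range ?_
    have := mem_range_of_mul_prime (A := A) (g := (algebraMap A L z ^ 3 * c 1) ^ 2) (ht 0)
      (m := t 3) (n := 1) (htt _ _ (by simp))
      ⟨_, f₃.trans (by simp only [map_mul, map_one]; ring)⟩ ⟨_, f₀.trans (by ring)⟩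
    simpa using this
  have h₂ : algebraMap A L z ^ 3 * c 2 ∈ (algebraMap A L).range := by
    refine mem_range_of_sq_mem_range ?_
    have := mem_range_of_mul_prime (A := A) (g := (algebraMap A L z ^ 3 * c 2) ^ 2) (ht 1)
      (m := t 2) (n := 1) (htt _ _ (by simp))
      ⟨_, f₂.trans (by simp only [map_mul, map_one]; ring)⟩ ⟨_, f₁.trans (by ring)⟩
    simpa using this
  have h₃ : algebraMap A L z ^ 3 * c 3 ∈ (algebraMap A L).range :=
    ⟨z * n, by rw [map_mul, hn]; ring⟩
  have h₀ : algebraMap A L z ^ 3 * c 0 ∈ (algebraMap A L).range := by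
    refine mem_range_of_sq_mem_range ?_
    obtain ⟨n₁, hn₁⟩ := h₁
    obtain ⟨n₂, hn₂⟩ := h₂
    refine ⟨z ^ 2 * G - n₁ ^ 2 * (t 0 * t 3 * z) - n₂ ^ 2 * (t 1 * t 2 * z), ?_⟩
    simp only [map_sub, map_mul, map_pow, hn₁, hn₂, hG]
    ring
  fin_cases i
  exacts [h₀, h₁, h₂, h₃]

/-- `1, p, q, p * q` are linearly independent over the squares, where `p = t 0 * t 3 * z` and
`q = t 1 * t 2 * z`. -/
theorem eq_zero_of_sum_sq_mul_eq_zero (ht : ∀ i, Prime (t i))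
    (htt : ∀ i j, i ≠ j → ¬ t i ∣ t j) (hD : ∀ i j, D i (t j) = if i = j then z else 0)
    (hz : ∀ i, D i z = 0) (hz0 : z ≠ 0) {c : Fin 4 → L}
    (h : ∑ i, c i ^ 2 * algebraMap A L
      ((![1, t 0 * t 3 * z, t 1 * t 2 * z, (t 0 * t 3 * z) * (t 1 * t 2 * z)] : Fin 4 → A) i) = 0) :
    c = 0 := by
  funext i
  by_contra hi
  replace hi : c i ≠ 0 := hi
  have h0 : algebraMap A L (t 0) ≠ 0 := by simpa using (ht 0).ne_zero
  have hz0' : algebraMap A L z ≠ 0 := by simpa using hz0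
  -- A vanishing sum may be rescaled freely. This scaling would make `z ^ 3 * (s * c i) = 1 / t 0`
  -- an element of `A`, although `t 0` is not a unit.
  let s := (algebraMap A L z ^ 3 * c i * algebraMap A L (t 0))⁻¹
  obtain ⟨n, hn⟩ := pow_three_mul_mem_range (F := 0) (c := fun j => s * c j) ht htt hD hz (by
    rw [map_zero, ← mul_zero (s ^ 2), ← h, Finset.mul_sum]
    exact Finset.sum_congr rfl fun i _ => by ring) i
  refine (ht 0).not_isUnit (IsUnit.of_mul_eq_one n (IsFractionRing.injective A L ?_))
  rw [map_mul, hn, map_one]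
  simp only [s]
  field_simp

end SquareClasses

/-! ### Construction of derivations of `A` -/

namespace QuadricHypersurface

open MvPolynomial

section Derivations

variable {K : Type u} [Field K]

/-- A family of values satisfying the linearized equation of the quadric extends to a derivation
of `A`. -/
theorem exists_derivation (τ : Fin 3 ⊕ Fin 3 → A K)
    (h : ∑ k, (coord K (Sum.inl k) * τ (Sum.inr k) + coord K (Sum.inr k) * τ (Sum.inl k)) = 0) :
    ∃ D : Derivation ℤ (A K) (A K), ∀ i, D (coord K i) = τ i := by
  -- A derivation is a ring homomorphism to the dual numbers over `A` that lifts the identity. It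
  -- passes to the localization since units are detected on first components, and to the quotient by
  -- the linearized equation `h`.
  let ψ₀ : Poly K →+* TrivSqZeroExt (A K) (A K) := eval₂Hom ((TrivSqZeroExt.inlHom (A K) (A K)).comp ((polyToA K).comp C))
    fun i => TrivSqZeroExt.inl (coord K i) + TrivSqZeroExt.inr (τ i)
  have hX (i) : ψ₀ (X i) = TrivSqZeroExt.inl (coord K i) + TrivSqZeroExt.inr (τ i) := by
    simp only [ψ₀, eval₂Hom_X']
  have hψ₀ (p : Poly K) : (ψ₀ p).fst = polyToA K p := by
    suffices h : (TrivSqZeroExt.fstHom (A K) (A K) (A K)).toRingHom.comp ψ₀ = polyToA K from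
      RingHom.congr_fun h p
    refine MvPolynomial.ringHom_ext (fun r => ?_) fun i => ?_
    · simp [ψ₀]
    · change (ψ₀ (X i)).fst = _
      rw [hX, TrivSqZeroExt.fst_add, TrivSqZeroExt.fst_inl, TrivSqZeroExt.fst_inr, add_zero,
        polyToA_X]
  have hu (s : (maxIdeal K).primeCompl) : IsUnit (ψ₀ s) := by
    rw [TrivSqZeroExt.isUnit_iff_isUnit_fst, hψ₀]
    exact isUnit_polyToA K s.2
  let ψ₁ : LocPoly K →+* TrivSqZeroExt (A K) (A K) := IsLocalization.lift hu
  have hψ₁ (p : Poly K) : ψ₁ (algebraMap (Poly K) (LocPoly K) p) = ψ₀ p := IsLocalization.lift_eq hu p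
  have hq : ψ₀ (quadric K) = 0 := by
    refine TrivSqZeroExt.ext ((hψ₀ _).trans (polyToA_quadric K)) ?_
    rw [Fin.sum_univ_three] at h
    simp only [quadric, map_add, map_mul, hX, TrivSqZeroExt.snd_add, TrivSqZeroExt.snd_mul,
      TrivSqZeroExt.fst_add, TrivSqZeroExt.fst_inl, TrivSqZeroExt.fst_inr, TrivSqZeroExt.snd_inl,
      TrivSqZeroExt.snd_inr, TrivSqZeroExt.snd_zero, smul_eq_mul, MulOpposite.smul_eq_mul_unop,
      MulOpposite.unop_op]
    linear_combination h
  let ψ : A K →+* TrivSqZeroExt (A K) (A K) := Ideal.Quotient.lift (quadricIdeal K) ψ₁ (by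
    suffices h : quadricIdeal K ≤ RingHom.ker ψ₁ from fun a ha => h ha
    rw [Ideal.span_singleton_le_iff_mem, RingHom.mem_ker, hψ₁, hq])
  have hψ (p : Poly K) : ψ (polyToA K p) = ψ₀ p := hψ₁ p
  have hfst (a : A K) : (ψ a).fst = a := by
    obtain ⟨s, hs, p, hp⟩ := exists_polyToA_mul_eq K a
    refine (isUnit_polyToA K hs).mul_left_cancel ?_
    rw [hp, ← hψ₀ p, ← hψ, ← hp, map_mul, TrivSqZeroExt.fst_mul, hψ, hψ₀]
  refine ⟨Derivation.mk' ((TrivSqZeroExt.sndHom (A K) (A K)).toAddMonoidHom.comp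
    ψ.toAddMonoidHom).toIntLinearMap fun a b => ?_, fun i => ?_⟩
  · change (ψ (a * b)).snd = a • (ψ b).snd + b • (ψ a).snd
    rw [map_mul, TrivSqZeroExt.snd_mul, hfst, hfst, op_smul_eq_smul]
  · change (ψ (coord K i)).snd = τ i
    rw [← polyToA_X, hψ, hX, TrivSqZeroExt.snd_add, TrivSqZeroExt.snd_inl, TrivSqZeroExt.snd_inr,
      zero_add]

instance [CharP K 2] : CharP (A K) 2 :=
  charP_of_injective_ringHom ((polyToA K).comp C).injective 2

/-- The indices of the variables other than those with number `k`, where `i, j, k` are distinct. -/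
def otherIndex (i j : Fin 3) : Fin 4 → Fin 3 ⊕ Fin 3 :=
  ![Sum.inl i, Sum.inl j, Sum.inr i, Sum.inr j]

theorem otherIndex_injective {i j : Fin 3} (hij : i ≠ j) :
    Function.Injective (otherIndex i j) := by
  intro l m
  fin_cases l <;> fin_cases m <;> simp [otherIndex, hij, hij.symm]

theorem otherIndex_ne {i j k : Fin 3} (hik : i ≠ k) (hjk : j ≠ k) (l : Fin 4) :
    otherIndex i j l ≠ Sum.inl k ∧ otherIndex i j l ≠ Sum.inr k := by
  fin_cases l <;> simp [otherIndex, hik, hjk]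

theorem exists_derivations [CharP K 2] {i j k : Fin 3} (hij : i ≠ j) (hik : i ≠ k) (hjk : j ≠ k) :
    ∃ D : Fin 4 → Derivation ℤ (A K) (A K),
      (∀ l m, D l (coord K (otherIndex i j m)) = if l = m then coord K (Sum.inr k) else 0) ∧
      ∀ l, D l (coord K (Sum.inr k)) = 0 := by
  -- Moving `t l` by `x_k` changes the quadric by `x_k` times the partner of `t l`; moving `u_k` by
  -- that partner contributes the same term again, and the two cancel in characteristic 2.
  have h (l : Fin 4) := exists_derivation (K := K) (fun m => if m = otherIndex i j l then
    coord K (Sum.inr k) else if m = Sum.inl k then coord K (otherIndex i j l).swap else 0) (by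
    have h₁ : (Finset.univ : Finset (Fin 3)) = {i, j, k} := by decide +revert
    have h₂ (m : Fin 3 ⊕ Fin 3) := CharTwo.add_self_eq_zero (coord K (Sum.inr k) * coord K m)
    rw [h₁, Finset.sum_insert (by simp [hij, hik]), Finset.sum_insert (by simp [hjk]),
      Finset.sum_singleton]
    fin_cases l <;>
      simp [otherIndex, hij, hik, hjk, hij.symm, hik.symm, hjk.symm, mul_comm _ (coord K (Sum.inr k)), h₂])
  choose D hD using h
  refine ⟨D, fun l m => ?_, fun l => ?_⟩
  · simp [hD, (otherIndex_ne hik hjk m).1, (otherIndex_injective hij).eq_iff, eq_comm]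
  · simp [hD, (otherIndex_ne hik hjk l).2.symm]

end Derivations

end QuadricHypersurface

/-! ### Multiplication table of `R` -/

namespace QuadricHypersurface

section MultiplicationTable

variable {K : Type u} [Field K]

theorem algebraMap_A_injective : Function.Injective (algebraMap (A K) (Ω K)) :=
  (IsScalarTower.algebraMap_eq (A K) (L K) (Ω K)).symm ▸
    (algebraMap (L K) (Ω K)).injective.comp (IsFractionRing.injective (A K) (L K))

theorem a_sq : a K ^ 2 = algebraMap (A K) (Ω K) (u K * y K * z K) := sqrt_sq _
theorem b_sq : b K ^ 2 = algebraMap (A K) (Ω K) (v K * x K * z K) := sqrt_sq _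
theorem c_sq : c K ^ 2 = algebraMap (A K) (Ω K) (w K * x K * y K) := sqrt_sq _
theorem d_sq : d K ^ 2 = algebraMap (A K) (Ω K) (u K * v K * w K) := sqrt_sq _
theorem e_sq : e K ^ 2 = algebraMap (A K) (Ω K) (v K * w K * y K * z K) := sqrt_sq _

variable [CharP K 2]

instance : CharP (Ω K) 2 := charP_of_injective_algebraMap algebraMap_A_injective 2

theorem eq_of_sq_eq_sq {f g : Ω K} (h : f ^ 2 = g ^ 2) : f = g := CharTwo.sq_injective h

/-- All relations below rest on this: square roots are unique in characteristic 2, so an identity in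
`Ω` reduces to one in `A`, settled by `relation` and `2 = 0`. -/
theorem eq_of_sq_eq_sq_of_eq {f g : Ω K} {p q : A K} (hf : f ^ 2 = algebraMap (A K) (Ω K) p)
    (hg : g ^ 2 = algebraMap (A K) (Ω K) q) (h : p = q) : f = g :=
  eq_of_sq_eq_sq (by rw [hf, hg, h])

theorem add_sq_eq {f g : Ω K} {p q : A K} (hf : f ^ 2 = algebraMap (A K) (Ω K) p)
    (hg : g ^ 2 = algebraMap (A K) (Ω K) q) : (f + g) ^ 2 = algebraMap (A K) (Ω K) (p + q) := by
  rw [CharTwo.add_sq, hf, hg, map_add]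

omit [CharP K 2] in
theorem mul_sq_eq {f g : Ω K} {p q : A K} (hf : f ^ 2 = algebraMap (A K) (Ω K) p)
    (hg : g ^ 2 = algebraMap (A K) (Ω K) q) : (f * g) ^ 2 = algebraMap (A K) (Ω K) (p * q) := by
  rw [mul_pow, hf, hg, map_mul]

omit [CharP K 2] in
theorem smul_sq_eq {g : Ω K} {q : A K} (r : A K)
    (hg : g ^ 2 = algebraMap (A K) (Ω K) q) :
    (r • g) ^ 2 = algebraMap (A K) (Ω K) (r ^ 2 * q) := by
  rw [Algebra.smul_def, mul_pow, hg, map_mul, map_pow]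

omit [CharP K 2] in
theorem one_sq_eq : (1 : Ω K) ^ 2 = algebraMap (A K) (Ω K) 1 := by rw [one_pow, map_one]

variable (K)

theorem z_smul_c : z K • c K = x K • a K + y K • b K := by
  refine eq_of_sq_eq_sq_of_eq (smul_sq_eq _ c_sq)
    (add_sq_eq (smul_sq_eq _ a_sq) (smul_sq_eq _ b_sq)) ?_
  linear_combination x K * y K * z K * relation K -
    x K * y K * z K * (u K * x K + v K * y K) * CharTwo.two_eq_zero (R := A K)

theorem z_smul_d : z K • d K = v K • a K + u K • b K := by
  refine eq_of_sq_eq_sq_of_eq (smul_sq_eq _ d_sq)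
    (add_sq_eq (smul_sq_eq _ a_sq) (smul_sq_eq _ b_sq)) ?_
  linear_combination u K * v K * z K * relation K -
    u K * v K * z K * (u K * x K + v K * y K) * CharTwo.two_eq_zero (R := A K)

theorem x_smul_d : x K • d K = w K • b K + v K • c K := by
  refine eq_of_sq_eq_sq_of_eq (smul_sq_eq _ d_sq)
    (add_sq_eq (smul_sq_eq _ b_sq) (smul_sq_eq _ c_sq)) ?_
  linear_combination v K * w K * x K * relation K -
    v K * w K * x K * (w K * z K + v K * y K) * CharTwo.two_eq_zero (R := A K)

theorem y_smul_d : y K • d K = w K • a K + u K • c K := by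
  refine eq_of_sq_eq_sq_of_eq (smul_sq_eq _ d_sq)
    (add_sq_eq (smul_sq_eq _ a_sq) (smul_sq_eq _ c_sq)) ?_
  linear_combination u K * w K * y K * relation K -
    u K * w K * y K * (w K * z K + u K * x K) * CharTwo.two_eq_zero (R := A K)

omit [CharP K 2] in
theorem a_mul_a : a K * a K = (u K * y K * z K) • (1 : Ω K) := by
  rw [← pow_two, a_sq, Algebra.algebraMap_eq_smul_one]

omit [CharP K 2] in
theorem b_mul_b : b K * b K = (v K * x K * z K) • (1 : Ω K) := by
  rw [← pow_two, b_sq, Algebra.algebraMap_eq_smul_one]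

omit [CharP K 2] in
theorem c_mul_c : c K * c K = (w K * x K * y K) • (1 : Ω K) := by
  rw [← pow_two, c_sq, Algebra.algebraMap_eq_smul_one]

omit [CharP K 2] in
theorem d_mul_d : d K * d K = (u K * v K * w K) • (1 : Ω K) := by
  rw [← pow_two, d_sq, Algebra.algebraMap_eq_smul_one]

omit [CharP K 2] in
theorem e_mul_e : e K * e K = (v K * w K * y K * z K) • (1 : Ω K) := by
  rw [← pow_two, e_sq, Algebra.algebraMap_eq_smul_one]

theorem a_mul_b : a K * b K = (v K * y K * z K) • (1 : Ω K) + z K • e K := by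
  refine eq_of_sq_eq_sq_of_eq (mul_sq_eq a_sq b_sq)
    (add_sq_eq (smul_sq_eq _ one_sq_eq) (smul_sq_eq _ e_sq)) ?_
  linear_combination v K * y K * z K ^ 2 * relation K -
    v K * y K * z K ^ 2 * (w K * z K + v K * y K) * CharTwo.two_eq_zero (R := A K)

theorem a_mul_c : a K * c K = (w K * y K * z K) • (1 : Ω K) + y K • e K := by
  refine eq_of_sq_eq_sq_of_eq (mul_sq_eq a_sq c_sq)
    (add_sq_eq (smul_sq_eq _ one_sq_eq) (smul_sq_eq _ e_sq)) ?_
  linear_combination w K * z K * y K ^ 2 * relation K -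
    w K * z K * y K ^ 2 * (w K * z K + v K * y K) * CharTwo.two_eq_zero (R := A K)

theorem b_mul_c : b K * c K = x K • e K := by
  refine eq_of_sq_eq_sq_of_eq (mul_sq_eq b_sq c_sq) (smul_sq_eq _ e_sq) ?_
  ring

theorem a_mul_d : a K * d K = u K • e K := by
  refine eq_of_sq_eq_sq_of_eq (mul_sq_eq a_sq d_sq) (smul_sq_eq _ e_sq) ?_
  ring

theorem b_mul_d : b K * d K = (v K * w K * z K) • (1 : Ω K) + v K • e K := by
  refine eq_of_sq_eq_sq_of_eq (mul_sq_eq b_sq d_sq)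
    (add_sq_eq (smul_sq_eq _ one_sq_eq) (smul_sq_eq _ e_sq)) ?_
  linear_combination w K * z K * v K ^ 2 * relation K -
    w K * z K * v K ^ 2 * (w K * z K + v K * y K) * CharTwo.two_eq_zero (R := A K)

theorem c_mul_d : c K * d K = (v K * w K * y K) • (1 : Ω K) + w K • e K := by
  refine eq_of_sq_eq_sq_of_eq (mul_sq_eq c_sq d_sq)
    (add_sq_eq (smul_sq_eq _ one_sq_eq) (smul_sq_eq _ e_sq)) ?_
  linear_combination v K * y K * w K ^ 2 * relation K -
    v K * y K * w K ^ 2 * (w K * z K + v K * y K) * CharTwo.two_eq_zero (R := A K)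

theorem a_mul_e : a K * e K = (y K * z K) • d K :=
  eq_of_sq_eq_sq_of_eq (mul_sq_eq a_sq e_sq) (smul_sq_eq _ d_sq) (by ring)

theorem b_mul_e : b K * e K = (v K * z K) • c K :=
  eq_of_sq_eq_sq_of_eq (mul_sq_eq b_sq e_sq) (smul_sq_eq _ c_sq) (by ring)

theorem c_mul_e : c K * e K = (w K * y K) • b K :=
  eq_of_sq_eq_sq_of_eq (mul_sq_eq c_sq e_sq) (smul_sq_eq _ b_sq) (by ring)

theorem d_mul_e : d K * e K = (v K * w K) • a K :=
  eq_of_sq_eq_sq_of_eq (mul_sq_eq d_sq e_sq) (smul_sq_eq _ a_sq) (by ring)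

/-- The module generators `1, a, b, c, d, e` of `R`. -/
noncomputable def gens (K : Type u) [Field K] : Fin 6 → Ω K := ![1, a K, b K, c K, d K, e K]

omit [CharP K 2] in
theorem range_gens : Set.range (gens K) = {1, a K, b K, c K, d K, e K} := by
  ext f
  constructor
  · rintro ⟨i, rfl⟩
    fin_cases i <;> simp [gens]
  · rintro (rfl | rfl | rfl | rfl | rfl | rfl)
    exacts [⟨0, rfl⟩, ⟨1, rfl⟩, ⟨2, rfl⟩, ⟨3, rfl⟩, ⟨4, rfl⟩, ⟨5, rfl⟩]

theorem gens_mul_gens_mem (i j : Fin 6) :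
    gens K i * gens K j ∈ Submodule.span (A K) (Set.range (gens K)) := by
  have hg (r : A K) (i : Fin 6) : r • gens K i ∈ Submodule.span (A K) (Set.range (gens K)) :=
    Submodule.smul_mem _ _ (Submodule.subset_span ⟨i, rfl⟩)
  have hg' (i : Fin 6) : gens K i ∈ Submodule.span (A K) (Set.range (gens K)) :=
    Submodule.subset_span ⟨i, rfl⟩
  wlog hij : i ≤ j generalizing i j
  · rw [mul_comm]
    exact this j i (le_of_not_ge hij)
  generalize Submodule.span (A K) (Set.range (gens K)) = N at *
  have key {f g : Ω K} (h : f = g) (hg : g ∈ N) : f ∈ N := h ▸ hg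
  fin_cases i <;> fin_cases j <;> try exact absurd hij (by decide)
  exacts [key (one_mul _) (hg' 0), key (one_mul _) (hg' 1), key (one_mul _) (hg' 2),
    key (one_mul _) (hg' 3), key (one_mul _) (hg' 4), key (one_mul _) (hg' 5),
    key (a_mul_a K) (hg _ 0), key (a_mul_b K) (N.add_mem (hg _ 0) (hg _ 5)),
    key (a_mul_c K) (N.add_mem (hg _ 0) (hg _ 5)), key (a_mul_d K) (hg _ 5),
    key (a_mul_e K) (hg _ 4), key (b_mul_b K) (hg _ 0), key (b_mul_c K) (hg _ 5),
    key (b_mul_d K) (N.add_mem (hg _ 0) (hg _ 5)), key (b_mul_e K) (hg _ 3),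
    key (c_mul_c K) (hg _ 0), key (c_mul_d K) (N.add_mem (hg _ 0) (hg _ 5)),
    key (c_mul_e K) (hg _ 2), key (d_mul_d K) (hg _ 0), key (d_mul_e K) (hg _ 1),
    key (e_mul_e K) (hg _ 0)]

theorem toSubmodule_R :
    Subalgebra.toSubmodule (R K) =
      Submodule.span (A K) {1, a K, b K, c K, d K, e K} := by
  rw [← range_gens]
  refine le_antisymm ?_ (Submodule.span_le.2 ?_)
  · let S : Subalgebra (A K) (Ω K) :=
      (Submodule.span (A K) (Set.range (gens K))).toSubalgebra (Submodule.subset_span ⟨0, rfl⟩)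
        fun f g hf hg => by
        have := Submodule.mul_mem_mul hf hg
        rw [Submodule.span_mul_span] at this
        refine (Submodule.span_le.2 ?_) this
        rintro _ ⟨_, ⟨i, rfl⟩, _, ⟨j, rfl⟩, rfl⟩
        exact gens_mul_gens_mem K i j
    have : R K ≤ S := by
      refine Algebra.adjoin_le ?_
      rintro _ (rfl | rfl | rfl | rfl | rfl)
      exacts [Submodule.subset_span ⟨1, rfl⟩, Submodule.subset_span ⟨2, rfl⟩,
        Submodule.subset_span ⟨3, rfl⟩, Submodule.subset_span ⟨4, rfl⟩,
        Submodule.subset_span ⟨5, rfl⟩]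
    exact this
  · rw [range_gens]
    rintro _ (rfl | rfl | rfl | rfl | rfl | rfl)
    exacts [one_mem (R K), a_mem K, b_mem K, c_mem K, d_mem K, e_mem K]

theorem mem_R_iff {f : Ω K} : f ∈ R K ↔ ∃ p₀ p₁ p₂ p₃ p₄ p₅ : A K,
    f = p₀ • 1 + p₁ • a K + p₂ • b K + p₃ • c K + p₄ • d K + p₅ • e K := by
  rw [← Subalgebra.mem_toSubmodule, toSubmodule_R, ← range_gens, Submodule.mem_span_range_iff_exists_fun]
  constructor
  · rintro ⟨p, rfl⟩
    exact ⟨p 0, p 1, p 2, p 3, p 4, p 5, by simp [Fin.sum_univ_six, gens]⟩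
  · rintro ⟨p₀, p₁, p₂, p₃, p₄, p₅, rfl⟩
    exact ⟨![p₀, p₁, p₂, p₃, p₄, p₅], by simp [Fin.sum_univ_six, gens]⟩

end MultiplicationTable

end QuadricHypersurface

/-! ### The biquadratic extension and bounded denominators -/

namespace QuadricHypersurface

section Biquadratic

variable {K : Type u} [Field K]

/-- The elements `1, f, g, f * g`, which span `L(f, g)` if `f` and `g` are square roots. -/
noncomputable def biquad (f g : Ω K) : Fin 4 → Ω K := ![1, f, g, f * g]

theorem mem_span_biquad {f g : Ω K} {p q : A K}
    (hf : f ^ 2 = algebraMap (A K) (Ω K) p) (hg : g ^ 2 = algebraMap (A K) (Ω K) q) {h : Ω K}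
    (hh : h ∈ IntermediateField.adjoin (L K) {f, g}) :
    h ∈ Submodule.span (L K) (Set.range (biquad f g)) := by
  obtain ⟨P, hP⟩ : ∃ P, f * f = algebraMap (L K) (Ω K) P :=
    ⟨algebraMap (A K) (L K) p, by rw [← IsScalarTower.algebraMap_apply, ← hf, pow_two]⟩
  obtain ⟨Q, hQ⟩ : ∃ Q, g * g = algebraMap (L K) (Ω K) Q :=
    ⟨algebraMap (A K) (L K) q, by rw [← IsScalarTower.algebraMap_apply, ← hg, pow_two]⟩
  have hm (i : Fin 4) : biquad f g i ∈ Submodule.span (L K) (Set.range (biquad f g)) :=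
    Submodule.subset_span ⟨i, rfl⟩
  let S : Subalgebra (L K) (Ω K) :=
    (Submodule.span (L K) (Set.range (biquad f g))).toSubalgebra (hm 0) fun s t hs ht => by
      have := Submodule.mul_mem_mul hs ht
      rw [Submodule.span_mul_span] at this
      refine (Submodule.span_le.2 ?_) this
      rintro _ ⟨_, ⟨i, rfl⟩, _, ⟨j, rfl⟩, rfl⟩
      change biquad f g i * biquad f g j ∈ _
      have key {r : Ω K} (l : L K) (i : Fin 4) (h : r = algebraMap (L K) (Ω K) l * biquad f g i) :
          r ∈ Submodule.span (L K) (Set.range (biquad f g)) := by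
        rw [h, ← Algebra.smul_def]
        exact Submodule.smul_mem _ _ (hm i)
      fin_cases i <;> fin_cases j <;> simp only [biquad] <;> dsimp
      · exact key 1 0 (by simp [biquad])
      · exact key 1 1 (by simp [biquad])
      · exact key 1 2 (by simp [biquad])
      · exact key 1 3 (by simp [biquad])
      · exact key 1 1 (by simp [biquad])
      · exact key P 0 (by simp [biquad, hP])
      · exact key 1 3 (by simp [biquad])
      · exact key P 2 (by simp [biquad, ← hP, mul_assoc])
      · exact key 1 2 (by simp [biquad])
      · exact key 1 3 (by simp [biquad, mul_comm])
      · exact key Q 0 (by simp [biquad, hQ])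
      · exact key Q 1 (by simp only [biquad, ← hQ]; dsimp; ring)
      · exact key 1 3 (by simp [biquad])
      · exact key P 2 (by simp only [biquad, ← hP]; dsimp; ring)
      · exact key Q 1 (by simp only [biquad, ← hQ]; dsimp; ring)
      · exact key (P * Q) 0 (by simp only [biquad, map_mul, ← hQ, ← hP]; dsimp; ring)
  have h₁ : h ∈ Algebra.adjoin (L K) {f, g} := by
    rw [← IntermediateField.adjoin_toSubalgebra]
    exact hh
  have h₂ : Algebra.adjoin (L K) {f, g} ≤ S := by
    refine Algebra.adjoin_le ?_
    rintro _ (rfl | rfl)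
    exacts [hm 1, hm 2]
  exact h₂ h₁

variable (K) in
theorem a_mem_M : a K ∈ M K := IntermediateField.subset_adjoin _ _ (by simp)

variable (K) in
theorem b_mem_M : b K ∈ M K := IntermediateField.subset_adjoin _ _ (by simp)

theorem smul_mem_intermediateField {N : IntermediateField (L K) (Ω K)} {f : Ω K} (r : A K)
    (hf : f ∈ N) : r • f ∈ N := by
  rw [← algebraMap_smul (L K) r]
  exact N.smul_mem hf

theorem mem_of_smul_mem {N : IntermediateField (L K) (Ω K)} {f : Ω K} {r : A K} (hr : r ≠ 0)
    (hf : r • f ∈ N) : f ∈ N := by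
  rw [← algebraMap_smul (L K) r] at hf
  have := N.smul_mem (x := (algebraMap (A K) (L K) r)⁻¹) hf
  rwa [inv_smul_smul₀] at this
  simpa using hr

variable (K) in
theorem span_biquad_eq_M :
    Submodule.span (L K) (Set.range (biquad (a K) (b K))) =
      Subalgebra.toSubmodule (M K).toSubalgebra := by
  refine le_antisymm (Submodule.span_le.2 ?_) fun h hh => mem_span_biquad a_sq b_sq hh
  rintro _ ⟨i, rfl⟩
  fin_cases i
  exacts [(M K).one_mem, a_mem_M K, b_mem_M K, (M K).mul_mem (a_mem_M K) (b_mem_M K)]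

variable [CharP K 2]

theorem sum_smul_biquad_sq {f g : Ω K} {p q : A K} (hf : f ^ 2 = algebraMap (A K) (Ω K) p)
    (hg : g ^ 2 = algebraMap (A K) (Ω K) q) (c : Fin 4 → L K) :
    (∑ i, c i • biquad f g i) ^ 2 = algebraMap (L K) (Ω K)
      (∑ i, c i ^ 2 * algebraMap (A K) (L K) ((![1, p, q, p * q] : Fin 4 → A K) i)) := by
  rw [CharTwo.sum_sq, map_sum]
  refine Finset.sum_congr rfl fun i _ => ?_
  rw [Algebra.smul_def, mul_pow, map_mul, map_pow, ← IsScalarTower.algebraMap_apply]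
  congr 1
  fin_cases i <;> simp [biquad, hf, hg, mul_pow]

/-- Squaring a linear dependence has no cross terms, so it becomes a vanishing sum of squares times
`1, p, q, p * q`. -/
theorem linearIndependent_biquad {i j k : Fin 3} (hij : i ≠ j) (hik : i ≠ k) (hjk : j ≠ k)
    {f g : Ω K}
    (hf : f ^ 2 = algebraMap (A K) (Ω K)
      (coord K (Sum.inl i) * coord K (Sum.inr j) * coord K (Sum.inr k)))
    (hg : g ^ 2 = algebraMap (A K) (Ω K)
      (coord K (Sum.inl j) * coord K (Sum.inr i) * coord K (Sum.inr k))) :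
    LinearIndependent (L K) (biquad f g) := by
  obtain ⟨D, hD, hz⟩ := exists_derivations (K := K) hij hik hjk
  refine Fintype.linearIndependent_iff.2 fun c hc => ?_
  have h₁ := sum_smul_biquad_sq hf hg c
  rw [hc, zero_pow two_ne_zero, eq_comm, map_eq_zero] at h₁
  exact congrFun (eq_zero_of_sum_sq_mul_eq_zero (t := fun l => coord K (otherIndex i j l))
    (fun l => prime_coord _) (fun l m h => not_coord_dvd_coord ((otherIndex_injective hij).ne h))
    hD hz (coord_ne_zero _) h₁)

/-- The square of `h` lies in `L` and is integral, hence lies in `A` by normality; the denominator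
bound for sums of squares then applies to the coordinates of `h`. -/
theorem pow_three_smul_eq {i j k : Fin 3} (hij : i ≠ j) (hik : i ≠ k) (hjk : j ≠ k)
    {f g : Ω K}
    (hf : f ^ 2 = algebraMap (A K) (Ω K)
      (coord K (Sum.inl i) * coord K (Sum.inr j) * coord K (Sum.inr k)))
    (hg : g ^ 2 = algebraMap (A K) (Ω K)
      (coord K (Sum.inl j) * coord K (Sum.inr i) * coord K (Sum.inr k)))
    {h : Ω K} (hh : h ∈ IntermediateField.adjoin (L K) {f, g}) (hi : IsIntegral (A K) h) :
    ∃ n : Fin 4 → A K, coord K (Sum.inr k) ^ 3 • h = ∑ l, n l • biquad f g l := by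
  obtain ⟨D, hD, hz⟩ := exists_derivations (K := K) hij hik hjk
  obtain ⟨c, rfl⟩ := (Submodule.mem_span_range_iff_exists_fun _).1 (mem_span_biquad hf hg hh)
  have h₁ := sum_smul_biquad_sq hf hg c
  have h₂ := hi.pow 2
  rw [h₁, isIntegral_algebraMap_iff (algebraMap (L K) (Ω K)).injective] at h₂
  obtain ⟨F, hF⟩ := IsIntegrallyClosed.isIntegral_iff.1 h₂
  choose n hn using pow_three_mul_mem_range (t := fun l => coord K (otherIndex i j l))
    (fun l => prime_coord _) (fun l m h => not_coord_dvd_coord ((otherIndex_injective hij).ne h))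
    hD hz hF
  refine ⟨n, ?_⟩
  rw [Finset.smul_sum]
  refine Finset.sum_congr rfl fun l _ => ?_
  rw [← algebraMap_smul (L K) (n l), hn, mul_smul, ← map_pow, algebraMap_smul]

theorem linearIndependent_biquad_a_b : LinearIndependent (L K) (biquad (a K) (b K)) :=
  linearIndependent_biquad (i := 0) (j := 1) (k := 2) (by decide) (by decide) (by decide)
    a_sq b_sq

variable (K)

theorem finrank_M : Module.finrank (L K) (M K) = 4 := by
  have h := finrank_span_eq_card (linearIndependent_biquad_a_b (K := K))
  rw [span_biquad_eq_M] at h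
  simpa using! h

theorem c_mem_M : c K ∈ M K := by
  refine mem_of_smul_mem (coord_ne_zero (Sum.inr 2)) (?_ : z K • c K ∈ M K)
  rw [z_smul_c]
  exact add_mem (smul_mem_intermediateField _ (a_mem_M K)) (smul_mem_intermediateField _ (b_mem_M K))

theorem d_mem_M : d K ∈ M K := by
  refine mem_of_smul_mem (coord_ne_zero (Sum.inr 2)) (?_ : z K • d K ∈ M K)
  rw [z_smul_d]
  exact add_mem (smul_mem_intermediateField _ (a_mem_M K)) (smul_mem_intermediateField _ (b_mem_M K))

theorem e_mem_M : e K ∈ M K := by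
  refine mem_of_smul_mem (coord_ne_zero (Sum.inr 2)) (?_ : z K • e K ∈ M K)
  rw [eq_sub_of_add_eq' (a_mul_b K).symm]
  exact sub_mem (mul_mem (a_mem_M K) (b_mem_M K)) (smul_mem_intermediateField _ (one_mem _))

/-- The pair `a, c` plays the role of `a, b` with `y` and `z` interchanged, which provides a second
denominator, prime to the first. -/
theorem M_le_adjoin_a_c : M K ≤ IntermediateField.adjoin (L K) {a K, c K} := by
  have ha : a K ∈ IntermediateField.adjoin (L K) {a K, c K} :=
    IntermediateField.subset_adjoin _ _ (by simp)
  have hc : c K ∈ IntermediateField.adjoin (L K) {a K, c K} :=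
    IntermediateField.subset_adjoin _ _ (by simp)
  refine IntermediateField.adjoin_le_iff.2 ?_
  rintro _ (rfl | rfl)
  · exact ha
  · refine mem_of_smul_mem (coord_ne_zero (Sum.inr 1)) (?_ : y K • b K ∈ _)
    rw [← sub_eq_of_eq_add' (z_smul_c K)]
    exact sub_mem (smul_mem_intermediateField _ hc) (smul_mem_intermediateField _ ha)

theorem R_le : R K ≤ integralClosure (A K) (Ω K) ⊓
    (M K).toSubalgebra.restrictScalars (A K) := by
  have hint {f : Ω K} {p : A K} (hf : f ^ 2 = algebraMap (A K) (Ω K) p) : IsIntegral (A K) f :=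
    .of_pow two_pos (hf ▸ isIntegral_algebraMap)
  refine Algebra.adjoin_le ?_
  rintro _ (rfl | rfl | rfl | rfl | rfl)
  exacts [⟨hint a_sq, a_mem_M K⟩, ⟨hint b_sq, b_mem_M K⟩, ⟨hint c_sq, c_mem_M K⟩,
    ⟨hint d_sq, d_mem_M K⟩, ⟨hint e_sq, e_mem_M K⟩]

theorem z_pow_three_smul_mem {f : Ω K} (hf : IsIntegral (A K) f) (hM : f ∈ M K) :
    z K ^ 3 • f ∈ R K := by
  obtain ⟨n, hn⟩ := pow_three_smul_eq (i := 0) (j := 1) (k := 2) (by decide) (by decide)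
    (by decide) a_sq b_sq hM hf
  have h : z K ^ 3 • f = ∑ l, n l • biquad (a K) (b K) l := hn
  rw [h]
  refine sum_mem fun l _ => (R K).smul_mem ?_ _
  fin_cases l
  exacts [one_mem _, a_mem K, b_mem K, mul_mem (a_mem K) (b_mem K)]

theorem y_pow_three_smul_mem {f : Ω K} (hf : IsIntegral (A K) f) (hM : f ∈ M K) :
    y K ^ 3 • f ∈ R K := by
  obtain ⟨n, hn⟩ := pow_three_smul_eq (i := 0) (j := 2) (k := 1) (by decide) (by decide)
    (by decide) (by rw [a_sq, u, y, z, mul_right_comm]) c_sq (M_le_adjoin_a_c K hM) hf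
  have h : y K ^ 3 • f = ∑ l, n l • biquad (a K) (c K) l := hn
  rw [h]
  refine sum_mem fun l _ => (R K).smul_mem ?_ _
  fin_cases l
  exacts [one_mem _, a_mem K, c_mem K, mul_mem (a_mem K) (c_mem K)]

end Biquadratic

end QuadricHypersurface

/-! ### A regular local ring `B` with `A` free on `1, x` -/

namespace QuadricHypersurface

open MvPolynomial

section Normalization

variable (K : Type u) [Field K]

/-- The ideal of the origin in `K[U, V, W, Y, Z]`. -/
noncomputable def freeMax : Ideal (FreePoly K) :=
  RingHom.ker (constantCoeff : FreePoly K →+* K)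

instance : (freeMax K).IsPrime := RingHom.ker_isPrime _

/-- The regular local ring over which `A` and `R` are finite and free. -/
abbrev B : Type u := Localization.AtPrime (freeMax K)

/-- The embedding of `K[U, V, W, Y, Z]` into `K[U, V, W, X, Y, Z]` that sends `U` to `U + X`. -/
noncomputable def shear : FreePoly K →ₐ[K] Poly K :=
  aeval fun i => if i.1 = Sum.inl 0 then X (Sum.inl 0) + X (Sum.inr 0) else X i.1

variable {K}

theorem shear_X_zero : shear K (X ⟨Sum.inl 0, by simp⟩) = X (Sum.inl 0) + X (Sum.inr 0) := by
  simp [shear]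

theorem shear_X_of_ne {i : FreeIndex} (hi : i.1 ≠ Sum.inl 0) : shear K (X i) = X i.1 := by
  simp [shear, hi]

theorem constantCoeff_shear (p : FreePoly K) : constantCoeff (shear K p) = constantCoeff p := by
  suffices h : (constantCoeff (R := K)).comp (shear K).toRingHom = constantCoeff from
    RingHom.congr_fun h p
  refine MvPolynomial.ringHom_ext (fun r => by simp [shear]) fun i => ?_
  by_cases hi : i.1 = Sum.inl 0 <;> simp [shear, hi]

theorem shear_mem_maxIdeal_iff (p : FreePoly K) : shear K p ∈ maxIdeal K ↔ p ∈ freeMax K := by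
  rw [maxIdeal_eq_ker, RingHom.mem_ker, constantCoeff_shear]
  rfl

theorem isUnit_polyToA_shear (s : (freeMax K).primeCompl) : IsUnit (polyToA K (shear K s)) :=
  isUnit_polyToA K fun h => s.2 ((shear_mem_maxIdeal_iff _).1 h)

noncomputable instance : Algebra (B K) (A K) :=
  (IsLocalization.lift (g := (polyToA K).comp (shear K).toRingHom) isUnit_polyToA_shear).toAlgebra

theorem algebraMap_B_A (p : FreePoly K) :
    algebraMap (B K) (A K) (algebraMap (FreePoly K) (B K) p) = polyToA K (shear K p) :=
  IsLocalization.lift_eq _ _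

variable (K)

/-- The variables as elements of `B`. -/
noncomputable def freeCoord (i : FreeIndex) : B K := algebraMap (FreePoly K) (B K) (X i)

/-- The element of `B` mapping to `u + x`. -/
noncomputable def tB : B K := freeCoord K ⟨Sum.inl 0, by simp⟩
noncomputable def vB : B K := freeCoord K ⟨Sum.inl 1, by simp⟩
noncomputable def wB : B K := freeCoord K ⟨Sum.inl 2, by simp⟩
noncomputable def yB : B K := freeCoord K ⟨Sum.inr 1, by simp⟩
noncomputable def zB : B K := freeCoord K ⟨Sum.inr 2, by simp⟩

theorem algebraMap_tB : algebraMap (B K) (A K) (tB K) = u K + x K := by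
  rw [tB, freeCoord, algebraMap_B_A, shear_X_zero, map_add]
  rfl

theorem algebraMap_vB : algebraMap (B K) (A K) (vB K) = v K := by
  rw [vB, freeCoord, algebraMap_B_A, shear_X_of_ne (by simp)]
  rfl

theorem algebraMap_wB : algebraMap (B K) (A K) (wB K) = w K := by
  rw [wB, freeCoord, algebraMap_B_A, shear_X_of_ne (by simp)]
  rfl

theorem algebraMap_yB : algebraMap (B K) (A K) (yB K) = y K := by
  rw [yB, freeCoord, algebraMap_B_A, shear_X_of_ne (by simp)]
  rfl

theorem algebraMap_zB : algebraMap (B K) (A K) (zB K) = z K := by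
  rw [zB, freeCoord, algebraMap_B_A, shear_X_of_ne (by simp)]
  rfl

variable {K}

theorem eq_zero_of_shear_add_shear_mul_X {p q : FreePoly K}
    (h : polyToA K (shear K p) + polyToA K (shear K q) * x K = 0) : p = 0 ∧ q = 0 := by
  let t : FreePoly K := X ⟨Sum.inl 0, by simp⟩
  -- In the coordinates `t = U + X` and `X`, the quadric is minus a monic quadratic in `X` over
  -- `K[t, V, W, Y, Z]`, so it divides no nonzero linear polynomial in `X`.
  let Θ : Poly K →ₐ[K] Polynomial (FreePoly K) := aeval fun i =>
    if h : i = Sum.inr 0 then Polynomial.X else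
      if i = Sum.inl 0 then Polynomial.C t - Polynomial.X else Polynomial.C (X ⟨i, h⟩)
  have hΘ (p : FreePoly K) : Θ (shear K p) = Polynomial.C p := by
    suffices h : Θ.comp (shear K) = (Algebra.ofId (FreePoly K) _).restrictScalars K from
      AlgHom.congr_fun h p
    refine MvPolynomial.algHom_ext fun i => ?_
    by_cases hi : i.1 = Sum.inl 0
    · obtain rfl : i = ⟨Sum.inl 0, by simp⟩ := Subtype.ext hi
      rw [AlgHom.comp_apply, shear_X_zero]
      simp [Θ, t, Algebra.ofId_apply]
    · rw [AlgHom.comp_apply, shear_X_of_ne hi]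
      simp [Θ, hi, i.2, Algebra.ofId_apply]
  have hx : Θ (X (Sum.inr 0)) = Polynomial.X := by simp [Θ]
  have h₁ : quadric K ∣ shear K p + shear K q * X (Sum.inr 0) := by
    rw [← polyToA_eq_zero_iff, map_add, map_mul]
    exact h
  have h₂ := map_dvd Θ h₁
  rw [map_add, map_mul, hΘ, hΘ, hx] at h₂
  obtain ⟨m, hm⟩ : ∃ m, Θ (quadric K) =
      - (Polynomial.X ^ 2 + (Polynomial.C (-t) * Polynomial.X + Polynomial.C m)) := by
    refine ⟨-(X ⟨Sum.inl 1, by simp⟩ * X ⟨Sum.inr 1, by simp⟩ +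
        X ⟨Sum.inl 2, by simp⟩ * X ⟨Sum.inr 2, by simp⟩), ?_⟩
    simp [Θ, quadric]
    ring
  have hmonic : (Polynomial.X ^ 2 + (Polynomial.C (-t) * Polynomial.X + Polynomial.C m)).Monic :=
    Polynomial.monic_X_pow_add (Polynomial.degree_linear_le.trans_lt (by norm_num))
  obtain ⟨r, hr⟩ := h₂
  rw [hm] at hr
  have h₃ : Polynomial.C p + Polynomial.C q * Polynomial.X = 0 := by
    by_contra hne
    refine hmonic.not_dvd_of_degree_lt hne ?_ ⟨-r, hr.trans (by ring)⟩
    rw [Polynomial.degree_add_eq_left_of_degree_lt (p := Polynomial.X ^ 2), Polynomial.degree_X_pow, add_comm]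
    · exact Polynomial.degree_linear_le.trans_lt (by norm_num)
    · rw [Polynomial.degree_X_pow]
      exact Polynomial.degree_linear_le.trans_lt (by norm_num)
  constructor
  · simpa using congrArg (fun f => Polynomial.coeff f 0) h₃
  · simpa using congrArg (fun f => Polynomial.coeff f 1) h₃

theorem eq_zero_of_algebraMap_add_mul_x {p q : B K}
    (h : algebraMap (B K) (A K) p + algebraMap (B K) (A K) q * x K = 0) : p = 0 ∧ q = 0 := by
  obtain ⟨p', s, rfl⟩ := IsLocalization.exists_mk'_eq (freeMax K).primeCompl p
  obtain ⟨q', s', rfl⟩ := IsLocalization.exists_mk'_eq (freeMax K).primeCompl q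
  have e (p' : FreePoly K) (s : (freeMax K).primeCompl) :
      algebraMap (B K) (A K) (IsLocalization.mk' (B K) p' s) * polyToA K (shear K s) =
        polyToA K (shear K p') := by
    rw [← algebraMap_B_A, ← map_mul, IsLocalization.mk'_spec, algebraMap_B_A]
  have h₁ : polyToA K (shear K (p' * s')) + polyToA K (shear K (q' * s)) * x K = 0 := by
    simp only [map_mul, ← e p' s, ← e q' s']
    linear_combination polyToA K (shear K s) * polyToA K (shear K s') * h
  obtain ⟨h₂, h₃⟩ := eq_zero_of_shear_add_shear_mul_X h₁
  have hs (s : (freeMax K).primeCompl) : (s : FreePoly K) ≠ 0 := fun h => s.2 (h ▸ zero_mem _)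
  rw [(mul_eq_zero.1 h₂).resolve_right (hs _), (mul_eq_zero.1 h₃).resolve_right (hs _)]
  simp

theorem x_sq : x K ^ 2 = (u K + x K) * x K + (v K * y K + w K * z K) := by
  linear_combination -relation K

variable (K) in
theorem exists_mem_freeMax_eq_add :
    ∃ t ∈ freeMax K, polyToA K (shear K t) = u K + x K := by
  refine ⟨X ⟨Sum.inl 0, by simp⟩, ?_, by rw [shear_X_zero, map_add]; rfl⟩
  change constantCoeff _ = 0
  simp

variable (K) in
theorem exists_mem_freeMax_eq_add_mul :
    ∃ m ∈ freeMax K, polyToA K (shear K m) = v K * y K + w K * z K := by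
  refine ⟨X ⟨Sum.inl 1, by simp⟩ * X ⟨Sum.inr 1, by simp⟩ +
      X ⟨Sum.inl 2, by simp⟩ * X ⟨Sum.inr 2, by simp⟩, ?_, ?_⟩
  · change constantCoeff _ = 0
    simp
  · rw [map_add, map_mul, map_mul, shear_X_of_ne (by simp), shear_X_of_ne (by simp),
      shear_X_of_ne (by simp), shear_X_of_ne (by simp)]
    simp only [map_add, map_mul, polyToA_X]
    rfl

theorem exists_polyToA_eq (p : Poly K) : ∃ p₀ p₁ : FreePoly K,
    polyToA K p = polyToA K (shear K p₀) + polyToA K (shear K p₁) * x K := by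
  obtain ⟨t, -, ht⟩ := exists_mem_freeMax_eq_add K
  obtain ⟨m, -, hm⟩ := exists_mem_freeMax_eq_add_mul K
  induction p using MvPolynomial.induction_on with
  | C a => exact ⟨C a, 0, by simp [shear]⟩
  | add p q hp hq =>
    obtain ⟨p₀, p₁, hp⟩ := hp
    obtain ⟨q₀, q₁, hq⟩ := hq
    refine ⟨p₀ + q₀, p₁ + q₁, ?_⟩
    simp only [map_add, hp, hq]
    ring
  | mul_X p i hp =>
    obtain ⟨p₀, p₁, hp⟩ := hp
    by_cases hi : i = Sum.inr 0
    · refine ⟨p₁ * m, p₀ + p₁ * t, ?_⟩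
      subst hi
      simp only [map_add, map_mul, ht, hm, hp, polyToA_X]
      change (_ + _) * x K = _
      linear_combination polyToA K (shear K p₁) * x_sq (K := K)
    · by_cases hi' : i = Sum.inl 0
      · refine ⟨p₀ * t - p₁ * m, - p₀, ?_⟩
        subst hi'
        simp only [map_sub, map_neg, map_mul, ht, hm, hp, polyToA_X]
        change (_ + _) * u K = _
        linear_combination polyToA K (shear K p₁) * relation K
      · refine ⟨p₀ * X ⟨i, hi⟩, p₁ * X ⟨i, hi⟩, ?_⟩
        rw [map_mul, hp, map_mul, map_mul, map_mul, map_mul, shear_X_of_ne hi', polyToA_X]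
        ring

theorem exists_eq_algebraMap_add_mul_x (f : A K) : ∃ p q : B K,
    f = algebraMap (B K) (A K) p + algebraMap (B K) (A K) q * x K := by
  obtain ⟨s, hs, g, hg⟩ := exists_polyToA_mul_eq K f
  obtain ⟨s₀, s₁, hs'⟩ := exists_polyToA_eq s
  obtain ⟨t, ht', ht⟩ := exists_mem_freeMax_eq_add K
  obtain ⟨m, hm', hm⟩ := exists_mem_freeMax_eq_add_mul K
  have hs₀ : s₀ ∉ freeMax K := by
    intro h
    have h₁ : polyToA K (s - (shear K s₀ + shear K s₁ * X (Sum.inr 0))) = 0 := by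
      rw [map_sub, map_add, map_mul, hs']
      exact sub_self _
    obtain ⟨r, hr⟩ := (polyToA_eq_zero_iff _).1 h₁
    refine hs ?_
    rw [sub_eq_iff_eq_add.1 hr]
    exact add_mem (Ideal.mul_mem_right _ _ (quadric_mem K))
      (add_mem ((shear_mem_maxIdeal_iff _).2 h)
        (Ideal.mul_mem_left _ _ (Ideal.subset_span ⟨_, rfl⟩)))
  -- `u` is the conjugate of `x` over `B`: their sum is `t` and their product is `-m`. So `n` is the
  -- norm of `s₀ + s₁ x`; it is congruent to `s₀²` modulo the maximal ideal, and denominators from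
  -- `A` can be moved into `B`.
  obtain ⟨n, hn, hn'⟩ : ∃ n ∉ freeMax K, polyToA K (shear K n) =
      polyToA K s * polyToA K (shear K s₀ + shear K s₁ * (X (Sum.inl 0))) := by
    refine ⟨s₀ ^ 2 + (s₀ * s₁ * t - s₁ ^ 2 * m), fun h => hs₀ ?_, ?_⟩
    · refine Ideal.IsPrime.mem_of_pow_mem inferInstance 2 ((Ideal.add_mem_iff_left _ ?_).1 h)
      exact sub_mem (Ideal.mul_mem_left _ _ ht') (Ideal.mul_mem_left _ _ hm')
    · rw [hs']
      simp only [map_add, map_sub, map_mul, map_pow, polyToA_X, ht, hm]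
      change _ = (_ + _) * (_ + _ * u K)
      linear_combination -polyToA K (shear K s₁) ^ 2 * relation K
  obtain ⟨q₀, q₁, hq⟩ := exists_polyToA_eq (g * (shear K s₀ + shear K s₁ * (X (Sum.inl 0))))
  let n' : (freeMax K).primeCompl := ⟨n, hn⟩
  refine ⟨IsLocalization.mk' _ q₀ n', IsLocalization.mk' _ q₁ n', ?_⟩
  have e (p' : FreePoly K) (s : (freeMax K).primeCompl) :
      algebraMap (B K) (A K) (IsLocalization.mk' (B K) p' s) * polyToA K (shear K s) =
        polyToA K (shear K p') := by
    rw [← algebraMap_B_A, ← map_mul, IsLocalization.mk'_spec, algebraMap_B_A]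
  refine (isUnit_polyToA_shear n').mul_right_cancel ?_
  rw [add_mul, mul_right_comm, e, e, ← hq, hn', map_mul, ← hg]
  ring

variable (K) in
/-- The basis `1, x` of `A` over `B`. -/
noncomputable def basisA : Module.Basis (Fin 2) (B K) (A K) :=
  Module.Basis.mk (v := ![1, x K])
    (LinearIndependent.pair_iff.2 fun p q h => eq_zero_of_algebraMap_add_mul_x (by
      rwa [Algebra.smul_def, Algebra.smul_def, mul_one] at h))
    (fun f _ => by
      obtain ⟨p, q, rfl⟩ := exists_eq_algebraMap_add_mul_x f
      rw [← Algebra.smul_def, Algebra.algebraMap_eq_smul_one]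
      exact add_mem (Submodule.smul_mem _ _ (Submodule.subset_span ⟨0, rfl⟩))
        (Submodule.smul_mem _ _ (Submodule.subset_span ⟨1, rfl⟩)))

theorem basisA_zero : basisA K 0 = 1 := by simp [basisA]

theorem basisA_one : basisA K 1 = x K := by simp [basisA]

instance : IsNoetherianRing (A K) :=
  inferInstanceAs (IsNoetherianRing (LocPoly K ⧸ quadricIdeal K))

end Normalization

end QuadricHypersurface

/-! ### Linear forms on `R` and its rank -/

namespace QuadricHypersurface

section Functionals

variable {K : Type u} [Field K]

theorem z_ne_zero : z K ≠ 0 := coord_ne_zero _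

theorem algebraMap_z_ne_zero : algebraMap (A K) (L K) (z K) ≠ 0 := by
  simpa using z_ne_zero

theorem map_smul_eq_mul (E : Ω K →ₗ[L K] L K) (r : A K) (f : Ω K) :
    E (r • f) = algebraMap (A K) (L K) r * E f := by
  rw [LinearMap.map_smul_of_tower, Algebra.smul_def]

variable [CharP K 2]

theorem exists_functional (c₀ c₁ c₂ c₃ : L K) : ∃ E : Ω K →ₗ[L K] L K,
    E 1 = c₀ ∧ E (a K) = c₁ ∧ E (b K) = c₂ ∧ E (a K * b K) = c₃ := by
  let β := Module.Basis.span (linearIndependent_biquad_a_b (K := K))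
  obtain ⟨E, hE⟩ := LinearMap.exists_extend (β.constr (L K) ![c₀, c₁, c₂, c₃])
  have key (i : Fin 4) : E (biquad (a K) (b K) i) = ![c₀, c₁, c₂, c₃] i := by
    rw [← Module.Basis.constr_basis β (L K) ![c₀, c₁, c₂, c₃] i, ← hE, LinearMap.comp_apply,
      Submodule.subtype_apply, Module.Basis.span_apply]
  exact ⟨E, key 0, key 1, key 2, key 3⟩

/-- Since `R` is spanned by the six generators, a form over `L` need only be checked on them to take
values in `A` on all of `R`. -/
theorem exists_restrict_functional (E : Ω K →ₗ[L K] L K)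
    (hE : ∀ i, E (gens K i) ∈ LinearMap.range (Algebra.linearMap (A K) (L K))) :
    ∃ G : R K →ₗ[A K] A K, ∀ r, algebraMap (A K) (L K) (G r) = E r := by
  have h (r : R K) : (E.restrictScalars (A K) ∘ₗ (R K).val.toLinearMap) r ∈
      LinearMap.range (Algebra.linearMap (A K) (L K)) := by
    have hr : (r : Ω K) ∈ Submodule.span (A K) (Set.range (gens K)) := by
      rw [range_gens, ← toSubmodule_R]
      exact r.2
    refine Submodule.span_le (p := (LinearMap.range (Algebra.linearMap (A K) (L K))).comap
      (E.restrictScalars (A K))) |>.2 ?_ hr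
    rintro _ ⟨i, rfl⟩
    exact hE i
  let ι := LinearEquiv.ofInjective (Algebra.linearMap (A K) (L K))
    (IsFractionRing.injective (A K) (L K))
  refine ⟨ι.symm.toLinearMap ∘ₗ LinearMap.codRestrict _ _ h, fun r => ?_⟩
  have := congrArg Subtype.val (ι.apply_symm_apply (LinearMap.codRestrict _ _ h r))
  exact this

variable (K) in
/-- The coefficient of `e` with respect to `1, a, b, e`. -/
theorem exists_coefficient_e : ∃ G : R K →ₗ[A K] A K,
    G 1 = 0 ∧ G ⟨a K, a_mem K⟩ = 0 ∧ G ⟨b K, b_mem K⟩ = 0 ∧ G ⟨c K, c_mem K⟩ = 0 ∧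
      G ⟨d K, d_mem K⟩ = 0 ∧ G ⟨e K, e_mem K⟩ = 1 := by
  -- As `ab = vyz + z e`, the value `z` at `ab` amounts to the value 1 at `e`.
  obtain ⟨E, h₁, ha, hb, hab⟩ := exists_functional 0 0 0 (algebraMap (A K) (L K) (z K))
  have hc : E (c K) = 0 := by
    have := congrArg E (z_smul_c K)
    rw [map_add, map_smul_eq_mul, map_smul_eq_mul, map_smul_eq_mul, ha, hb] at this
    simpa [z_ne_zero] using this
  have hd : E (d K) = 0 := by
    have := congrArg E (z_smul_d K)
    rw [map_add, map_smul_eq_mul, map_smul_eq_mul, map_smul_eq_mul, ha, hb] at this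
    simpa [z_ne_zero] using this
  have he : E (e K) = 1 := by
    have := congrArg E (a_mul_b K)
    rw [map_add, map_smul_eq_mul, map_smul_eq_mul, h₁, hab] at this
    simpa [z_ne_zero] using this
  obtain ⟨G, hG⟩ := exists_restrict_functional E fun i => by
    fin_cases i
    exacts [⟨0, (map_zero _).trans h₁.symm⟩, ⟨0, (map_zero _).trans ha.symm⟩,
      ⟨0, (map_zero _).trans hb.symm⟩, ⟨0, (map_zero _).trans hc.symm⟩,
      ⟨0, (map_zero _).trans hd.symm⟩, ⟨1, (map_one (algebraMap (A K) (L K))).trans he.symm⟩]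
  have inj := IsFractionRing.injective (A K) (L K)
  refine ⟨G, inj ?_, inj ?_, inj ?_, inj ?_, inj ?_, inj ?_⟩ <;>
    simp [hG, h₁, ha, hb, hc, hd, he]

variable (K) in
/-- The functional with `a ↦ u`, `b ↦ v`, `c ↦ w` that kills `1`, `d` and `e`. -/
theorem exists_functional_u_v_w : ∃ G : R K →ₗ[A K] A K,
    G 1 = 0 ∧ G ⟨a K, a_mem K⟩ = u K ∧ G ⟨b K, b_mem K⟩ = v K ∧ G ⟨c K, c_mem K⟩ = w K ∧
      G ⟨d K, d_mem K⟩ = 0 ∧ G ⟨e K, e_mem K⟩ = 0 := by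
  obtain ⟨E, h₁, ha, hb, hab⟩ := exists_functional 0 (algebraMap (A K) (L K) (u K))
    (algebraMap (A K) (L K) (v K)) 0
  have hc : E (c K) = algebraMap (A K) (L K) (w K) := by
    have := congrArg E (z_smul_c K)
    rw [map_add, map_smul_eq_mul, map_smul_eq_mul, map_smul_eq_mul, ha, hb, ← map_mul, ← map_mul,
      ← map_add] at this
    refine mul_left_cancel₀ algebraMap_z_ne_zero (this.trans ?_)
    rw [← map_mul]
    congr 1
    linear_combination relation K - CharTwo.add_self_eq_zero (z K * w K)
  have hd : E (d K) = 0 := by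
    have := congrArg E (z_smul_d K)
    rw [map_add, map_smul_eq_mul, map_smul_eq_mul, map_smul_eq_mul, ha, hb, ← map_mul, ← map_mul,
      ← map_add, mul_comm (v K) (u K), CharTwo.add_self_eq_zero] at this
    simpa [z_ne_zero] using this
  have he : E (e K) = 0 := by
    have := congrArg E (a_mul_b K)
    rw [map_add, map_smul_eq_mul, map_smul_eq_mul, h₁, hab] at this
    simpa [z_ne_zero] using this
  obtain ⟨G, hG⟩ := exists_restrict_functional E fun i => by
    fin_cases i
    exacts [⟨0, (map_zero _).trans h₁.symm⟩, ⟨_, ha.symm⟩, ⟨_, hb.symm⟩, ⟨_, hc.symm⟩,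
      ⟨0, (map_zero _).trans hd.symm⟩, ⟨0, (map_zero _).trans he.symm⟩]
  have inj := IsFractionRing.injective (A K) (L K)
  refine ⟨G, inj ?_, inj ?_, inj ?_, inj ?_, inj ?_, inj ?_⟩ <;>
    simp [hG, h₁, ha, hb, hc, hd, he]

theorem eq_zero_of_smul_add_eq_zero {p q r s : A K}
    (h : p • (1 : Ω K) + q • a K + r • b K + s • e K = 0) : p = 0 ∧ q = 0 ∧ r = 0 ∧ s = 0 := by
  have h₁ : (z K * p - s * (v K * y K * z K)) • (1 : Ω K) + (z K * q) • a K + (z K * r) • b K +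
      s • (a K * b K) = 0 := by
    rw [a_mul_b]
    linear_combination (norm := module) z K • h
  have h₂ := Fintype.linearIndependent_iff.1 (linearIndependent_biquad_a_b (K := K))
    (fun i => algebraMap (A K) (L K) (![z K * p - s * (v K * y K * z K), z K * q, z K * r, s] i))
    (by simpa [Fin.sum_univ_four, biquad] using h₁)
  have hs : s = 0 := by simpa using h₂ 3
  subst hs
  exact ⟨by simpa [z_ne_zero] using h₂ 0, by simpa [z_ne_zero] using h₂ 1,
    by simpa [z_ne_zero] using h₂ 2, rfl⟩

variable (K) in
theorem rank_R : Module.rank (A K) (R K) = 4 := by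
  apply le_antisymm
  · have : Module.Finite (L K) (M K) := Module.finite_of_finrank_pos (by simp [finrank_M])
    have h : Module.rank (A K) (M K) = 4 := by
      rw [← IsLocalization.rank_eq (L K) (nonZeroDivisors (A K)) le_rfl,
        ← Module.finrank_eq_rank, finrank_M]
      rfl
    rw [← h]
    exact LinearMap.rank_le_of_injective
      (Submodule.inclusion (show Subalgebra.toSubmodule (R K) ≤
        ((M K).toSubalgebra.toSubmodule.restrictScalars (A K)) from fun r hr => (R_le K hr).2))
      (Submodule.inclusion_injective _)
  · have h : LinearIndependent (A K)
        ![(1 : R K), ⟨a K, a_mem K⟩, ⟨b K, b_mem K⟩, ⟨e K, e_mem K⟩] := by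
      refine Fintype.linearIndependent_iff.2 fun g hg => ?_
      have h₁ := congrArg Subtype.val hg
      rw [Fin.sum_univ_four] at h₁
      obtain ⟨h₂, h₃, h₄, h₅⟩ := eq_zero_of_smul_add_eq_zero h₁
      intro i
      fin_cases i
      exacts [h₂, h₃, h₄, h₅]
    simpa using h.cardinal_lift_le_rank

instance : Module.Finite (A K) (R K) := by
  refine Module.Finite.iff_fg.2 (?_ : (Subalgebra.toSubmodule (R K)).FG)
  rw [toSubmodule_R, ← range_gens]
  exact Submodule.fg_span (Set.finite_range _)

instance : IsNoetherianRing (R K) := IsNoetherianRing.of_finite (A K) (R K)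

end Functionals

end QuadricHypersurface

/-! ### Dual bases for a linear form -/

section DualFamilies

variable {B R ι : Type*} [CommRing B] [CommRing R] [Algebra B R] [Fintype ι] [DecidableEq ι]
  {φ : R →ₗ[B] B} {e r : ι → R}

theorem apply_sum_smul_mul_of_dual (h : ∀ i j, φ (e j * r i) = if j = i then 1 else 0) (g : ι → B)
    (i : ι) : φ ((∑ j, g j • e j) * r i) = g i := by
  simp [Finset.sum_mul, h]

theorem free_of_dual (he : ⊤ ≤ Submodule.span B (Set.range e))
    (h : ∀ i j, φ (e j * r i) = if j = i then 1 else 0) : Module.Free B R := by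
  refine Module.Free.of_basis (Module.Basis.mk (Fintype.linearIndependent_iff.2 fun g hg i => ?_) he)
  rw [← apply_sum_smul_mul_of_dual h g i, hg, zero_mul, map_zero]

/-- Pairing with `r i` reads off the `i`-th coefficient, which gives injectivity; a form `l` is
represented by `∑ l (e i) • r i`. -/
theorem bijective_of_dual (he : ⊤ ≤ Submodule.span B (Set.range e))
    (h : ∀ i j, φ (e j * r i) = if j = i then 1 else 0) :
    Function.Bijective fun s : R => φ ∘ₗ LinearMap.mulRight B s := by
  constructor
  · intro s s' hs
    obtain ⟨g, hg⟩ := (Submodule.mem_span_range_iff_exists_fun B).1 (he (Submodule.mem_top (x := s - s')))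
    have hg' : g = 0 := funext fun i => by
      rw [← apply_sum_smul_mul_of_dual h g i, hg, mul_comm, mul_sub, map_sub]
      exact sub_eq_zero.2 (LinearMap.congr_fun hs (r i))
    rw [← sub_eq_zero, ← hg, hg']
    simp
  · intro l
    refine ⟨∑ i, l (e i) • r i, LinearMap.ext_on (eq_top_iff.2 he) ?_⟩
    rintro _ ⟨j, rfl⟩
    simp [Finset.mul_sum, h]

end DualFamilies

/-! ### `R` as a Frobenius algebra over `B` -/

namespace QuadricHypersurface

section Frobenius

variable {K : Type u} [Field K]

variable (K) in
/-- The coefficient of `x` with respect to the basis `1, x` of `A` over `B`. -/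
noncomputable def coeffX : A K →ₗ[B K] B K := (basisA K).coord 1

theorem coeffX_one : coeffX K 1 = 0 := by
  rw [← basisA_zero, coeffX, Module.Basis.coord_apply, Module.Basis.repr_self]
  simp

theorem coeffX_x : coeffX K (x K) = 1 := by
  rw [← basisA_one, coeffX, Module.Basis.coord_apply, Module.Basis.repr_self]
  simp

theorem coeffX_algebraMap (p : B K) : coeffX K (algebraMap (B K) (A K) p) = 0 := by
  rw [Algebra.algebraMap_eq_smul_one, map_smul, coeffX_one, smul_zero]

theorem coeffX_v : coeffX K (v K) = 0 := by rw [← algebraMap_vB, coeffX_algebraMap]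
theorem coeffX_w : coeffX K (w K) = 0 := by rw [← algebraMap_wB, coeffX_algebraMap]
theorem coeffX_y : coeffX K (y K) = 0 := by rw [← algebraMap_yB, coeffX_algebraMap]
theorem coeffX_z : coeffX K (z K) = 0 := by rw [← algebraMap_zB, coeffX_algebraMap]

theorem coeffX_u_mul_x : coeffX K (u K * x K) = 0 := by
  have : u K * x K = algebraMap (B K) (A K) (-(vB K * yB K + wB K * zB K)) := by
    simp only [map_neg, map_add, map_mul, algebraMap_vB, algebraMap_wB, algebraMap_yB,
      algebraMap_zB]
    linear_combination relation K
  rw [this, coeffX_algebraMap]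

variable (K)

/-- The elements `1, x, e, xe, a, b, c, d`, a basis of `R` over `B`. -/
noncomputable def basisVec : Fin 8 → R K :=
  ![1, x K • 1, ⟨e K, e_mem K⟩, x K • ⟨e K, e_mem K⟩, ⟨a K, a_mem K⟩, ⟨b K, b_mem K⟩,
    ⟨c K, c_mem K⟩, ⟨d K, d_mem K⟩]

/-- The basis of `R` over `B` dual to `1, x, e, xe, a, b, c, d` with respect to the form that takes
the coefficient of `xe` of the product. -/
noncomputable def dualVec : Fin 8 → R K :=
  ![u K • ⟨e K, e_mem K⟩, ⟨e K, e_mem K⟩, u K • 1, 1, ⟨d K, d_mem K⟩, ⟨c K, c_mem K⟩,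
    ⟨b K, b_mem K⟩, ⟨a K, a_mem K⟩]

variable [CharP K 2]

variable {K} in
theorem coeffX_u : coeffX K (u K) = 1 := by
  have : u K = algebraMap (B K) (A K) (tB K) + x K := by
    rw [algebraMap_tB, add_assoc, CharTwo.add_self_eq_zero, add_zero]
  rw [this, map_add, coeffX_algebraMap, coeffX_x, zero_add]

variable {K} in
-- The quadratic equation of `x` handles `1, x, e, xe`. For the others, `x a` and `x d` come from
-- the table, and `x b = t b + u b`, `x c = t c + u c` with `t = u + x` in `B`, where `u b = v a + z
-- d` and `u c = w a + y d`.
theorem x_smul_basisVec_mem (i : Fin 8) :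
    x K • basisVec K i ∈ Submodule.span (B K) (Set.range (basisVec K)) := by
  have hm (i : Fin 8) : basisVec K i ∈ Submodule.span (B K) (Set.range (basisVec K)) :=
    Submodule.subset_span ⟨i, rfl⟩
  have key {f : R K} (p q r : B K) (i j k : Fin 8)
      (h : f = algebraMap (B K) (A K) p • basisVec K i + algebraMap (B K) (A K) q • basisVec K j +
        algebraMap (B K) (A K) r • basisVec K k) :
      f ∈ Submodule.span (B K) (Set.range (basisVec K)) := by
    rw [h, algebraMap_smul, algebraMap_smul, algebraMap_smul]
    exact add_mem (add_mem (Submodule.smul_mem _ _ (hm i)) (Submodule.smul_mem _ _ (hm j)))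
      (Submodule.smul_mem _ _ (hm k))
  have hx (f : R K) : x K • x K • f = algebraMap (B K) (A K) (tB K) • x K • f +
      algebraMap (B K) (A K) (vB K * yB K + wB K * zB K) • f := by
    rw [map_add, map_mul, map_mul, algebraMap_vB, algebraMap_wB, algebraMap_yB, algebraMap_zB,
      algebraMap_tB, smul_smul, smul_smul, ← add_smul, ← pow_two, x_sq]
  fin_cases i
  · exact hm 1
  · exact key (tB K) (vB K * yB K + wB K * zB K) 0 1 0 0 ((hx 1).trans
      (by rw [map_zero, zero_smul _ (basisVec K 0), add_zero]; rfl))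
  · exact hm 3
  · exact key (tB K) (vB K * yB K + wB K * zB K) 0 3 2 0 ((hx ⟨e K, e_mem K⟩).trans
      (by rw [map_zero, zero_smul _ (basisVec K 0), add_zero]; rfl))
  · refine key (yB K) (zB K) 0 5 6 0 (Subtype.ext ?_)
    rw [algebraMap_yB, algebraMap_zB, map_zero]
    change x K • a K = y K • b K + z K • c K + (0 : A K) • (1 : Ω K)
    rw [z_smul_c, zero_smul, add_zero, add_left_comm, CharTwo.add_self_eq_zero, add_zero]
  · refine key (tB K) (vB K) (zB K) 5 4 7 (Subtype.ext ?_)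
    rw [algebraMap_tB, algebraMap_vB, algebraMap_zB]
    change x K • b K = (u K + x K) • b K + v K • a K + z K • d K
    rw [z_smul_d]
    linear_combination (norm := module) -CharTwo.add_self_eq_zero (u K • b K + v K • a K)
  · refine key (tB K) (wB K) (yB K) 6 4 7 (Subtype.ext ?_)
    rw [algebraMap_tB, algebraMap_wB, algebraMap_yB]
    change x K • c K = (u K + x K) • c K + w K • a K + y K • d K
    rw [y_smul_d]
    linear_combination (norm := module) -CharTwo.add_self_eq_zero (u K • c K + w K • a K)
  · refine key (wB K) (vB K) 0 5 6 0 (Subtype.ext ?_)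
    rw [algebraMap_wB, algebraMap_vB, map_zero]
    change x K • d K = w K • b K + v K • c K + (0 : A K) • (1 : Ω K)
    rw [x_smul_d, zero_smul, add_zero]

theorem span_basisVec : ⊤ ≤ Submodule.span (B K) (Set.range (basisVec K)) := by
  have hx (f : R K) (hf : f ∈ Submodule.span (B K) (Set.range (basisVec K))) :
      x K • f ∈ Submodule.span (B K) (Set.range (basisVec K)) := by
    induction hf using Submodule.span_induction with
    | mem f hf =>
      obtain ⟨i, rfl⟩ := hf
      exact x_smul_basisVec_mem i
    | zero => simp
    | add f g _ _ hf hg => rw [smul_add]; exact add_mem hf hg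
    | smul p f _ hf => rw [smul_comm]; exact Submodule.smul_mem _ _ hf
  have hA (s : A K) (i : Fin 8) :
      s • basisVec K i ∈ Submodule.span (B K) (Set.range (basisVec K)) := by
    obtain ⟨p, q, rfl⟩ := exists_eq_algebraMap_add_mul_x s
    have hi : basisVec K i ∈ Submodule.span (B K) (Set.range (basisVec K)) :=
      Submodule.subset_span ⟨i, rfl⟩
    rw [add_smul, mul_smul, algebraMap_smul, algebraMap_smul]
    exact add_mem (Submodule.smul_mem _ _ hi) (Submodule.smul_mem _ _ (hx _ hi))
  intro f _
  obtain ⟨p₀, p₁, p₂, p₃, p₄, p₅, hf⟩ := (mem_R_iff K).1 f.2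
  have : f = p₀ • basisVec K 0 + p₁ • basisVec K 4 + p₂ • basisVec K 5 + p₃ • basisVec K 6 +
      p₄ • basisVec K 7 + p₅ • basisVec K 2 := Subtype.ext hf
  rw [this]
  exact add_mem (add_mem (add_mem (add_mem (add_mem (hA _ _) (hA _ _)) (hA _ _)) (hA _ _))
    (hA _ _)) (hA _ _)

/-- The form takes the `x`-coefficient of the `e`-coefficient. Under the first, `1, x` is dual to
`u, 1`, because `u x ∈ B` and `u = t + x`. Among `a, b, c, d`, the products `ad` and `bc` have
`e`-coefficients `u` and `x`; all others have `0, v, w, y` or `z`, which come from `B`. -/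
theorem exists_dual : ∃ φ : R K →ₗ[B K] B K,
    ∀ i j, φ (basisVec K j * dualVec K i) = if j = i then 1 else 0 := by
  obtain ⟨G, h₁, ha, hb, hc, hd, he⟩ := exists_coefficient_e K
  have key {f g k : Ω K} {p q : A K} (hf : f ∈ R K) (hg : g ∈ R K) (hk : k ∈ R K)
      (h : f * g = p • 1 + q • k) : G (⟨f, hf⟩ * ⟨g, hg⟩) = q * G ⟨k, hk⟩ := by
    have : (⟨f, hf⟩ * ⟨g, hg⟩ : R K) = p • 1 + q • ⟨k, hk⟩ := Subtype.ext h
    rw [this, map_add, map_smul, map_smul, h₁, smul_zero, zero_add, smul_eq_mul]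
  have key' {f g k : Ω K} {q : A K} (hf : f ∈ R K) (hg : g ∈ R K) (hk : k ∈ R K)
      (h : f * g = q • k) : G (⟨f, hf⟩ * ⟨g, hg⟩) = q * G ⟨k, hk⟩ := by
    have : (⟨f, hf⟩ * ⟨g, hg⟩ : R K) = q • ⟨k, hk⟩ := Subtype.ext h
    rw [this, map_smul, smul_eq_mul]
  have haa : G (⟨a K, a_mem K⟩ * ⟨a K, a_mem K⟩) = 0 :=
    ((key' (a_mem K) (a_mem K) (one_mem _) (a_mul_a K)).trans
    (by rw [show G ⟨1, one_mem _⟩ = 0 from h₁, mul_zero]))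
  have hab : G (⟨a K, a_mem K⟩ * ⟨b K, b_mem K⟩) = z K :=
    ((key (a_mem K) (b_mem K) (e_mem K) (a_mul_b K)).trans
    (by rw [he, mul_one]))
  have hba : G (⟨b K, b_mem K⟩ * ⟨a K, a_mem K⟩) = z K :=
    (congrArg G (mul_comm _ _)).trans hab
  have hac : G (⟨a K, a_mem K⟩ * ⟨c K, c_mem K⟩) = y K :=
    ((key (a_mem K) (c_mem K) (e_mem K) (a_mul_c K)).trans
    (by rw [he, mul_one]))
  have hca : G (⟨c K, c_mem K⟩ * ⟨a K, a_mem K⟩) = y K :=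
    (congrArg G (mul_comm _ _)).trans hac
  have had : G (⟨a K, a_mem K⟩ * ⟨d K, d_mem K⟩) = u K :=
    ((key' (a_mem K) (d_mem K) (e_mem K) (a_mul_d K)).trans
    (by rw [he, mul_one]))
  have hda : G (⟨d K, d_mem K⟩ * ⟨a K, a_mem K⟩) = u K :=
    (congrArg G (mul_comm _ _)).trans had
  have hae : G (⟨a K, a_mem K⟩ * ⟨e K, e_mem K⟩) = 0 :=
    ((key' (a_mem K) (e_mem K) (d_mem K) (a_mul_e K)).trans
    (by rw [hd, mul_zero]))
  have hea : G (⟨e K, e_mem K⟩ * ⟨a K, a_mem K⟩) = 0 :=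
    (congrArg G (mul_comm _ _)).trans hae
  have hbb : G (⟨b K, b_mem K⟩ * ⟨b K, b_mem K⟩) = 0 :=
    ((key' (b_mem K) (b_mem K) (one_mem _) (b_mul_b K)).trans
    (by rw [show G ⟨1, one_mem _⟩ = 0 from h₁, mul_zero]))
  have hbc : G (⟨b K, b_mem K⟩ * ⟨c K, c_mem K⟩) = x K :=
    ((key' (b_mem K) (c_mem K) (e_mem K) (b_mul_c K)).trans
    (by rw [he, mul_one]))
  have hcb : G (⟨c K, c_mem K⟩ * ⟨b K, b_mem K⟩) = x K :=
    (congrArg G (mul_comm _ _)).trans hbc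
  have hbd : G (⟨b K, b_mem K⟩ * ⟨d K, d_mem K⟩) = v K :=
    ((key (b_mem K) (d_mem K) (e_mem K) (b_mul_d K)).trans
    (by rw [he, mul_one]))
  have hdb : G (⟨d K, d_mem K⟩ * ⟨b K, b_mem K⟩) = v K :=
    (congrArg G (mul_comm _ _)).trans hbd
  have hbe : G (⟨b K, b_mem K⟩ * ⟨e K, e_mem K⟩) = 0 :=
    ((key' (b_mem K) (e_mem K) (c_mem K) (b_mul_e K)).trans
    (by rw [hc, mul_zero]))
  have heb : G (⟨e K, e_mem K⟩ * ⟨b K, b_mem K⟩) = 0 :=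
    (congrArg G (mul_comm _ _)).trans hbe
  have hcc : G (⟨c K, c_mem K⟩ * ⟨c K, c_mem K⟩) = 0 :=
    ((key' (c_mem K) (c_mem K) (one_mem _) (c_mul_c K)).trans
    (by rw [show G ⟨1, one_mem _⟩ = 0 from h₁, mul_zero]))
  have hcd : G (⟨c K, c_mem K⟩ * ⟨d K, d_mem K⟩) = w K :=
    ((key (c_mem K) (d_mem K) (e_mem K) (c_mul_d K)).trans
    (by rw [he, mul_one]))
  have hdc : G (⟨d K, d_mem K⟩ * ⟨c K, c_mem K⟩) = w K :=
    (congrArg G (mul_comm _ _)).trans hcd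
  have hce : G (⟨c K, c_mem K⟩ * ⟨e K, e_mem K⟩) = 0 :=
    ((key' (c_mem K) (e_mem K) (b_mem K) (c_mul_e K)).trans
    (by rw [hb, mul_zero]))
  have hec : G (⟨e K, e_mem K⟩ * ⟨c K, c_mem K⟩) = 0 :=
    (congrArg G (mul_comm _ _)).trans hce
  have hdd : G (⟨d K, d_mem K⟩ * ⟨d K, d_mem K⟩) = 0 :=
    ((key' (d_mem K) (d_mem K) (one_mem _) (d_mul_d K)).trans
    (by rw [show G ⟨1, one_mem _⟩ = 0 from h₁, mul_zero]))
  have hde : G (⟨d K, d_mem K⟩ * ⟨e K, e_mem K⟩) = 0 :=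
    ((key' (d_mem K) (e_mem K) (a_mem K) (d_mul_e K)).trans
    (by rw [ha, mul_zero]))
  have hed : G (⟨e K, e_mem K⟩ * ⟨d K, d_mem K⟩) = 0 :=
    (congrArg G (mul_comm _ _)).trans hde
  have hee : G (⟨e K, e_mem K⟩ * ⟨e K, e_mem K⟩) = 0 :=
    ((key' (e_mem K) (e_mem K) (one_mem _) (e_mul_e K)).trans
    (by rw [show G ⟨1, one_mem _⟩ = 0 from h₁, mul_zero]))
  refine ⟨coeffX K ∘ₗ G.restrictScalars (B K), fun i j => ?_⟩
  rw [LinearMap.comp_apply, LinearMap.restrictScalars_apply]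
  clear key key'
  unfold basisVec dualVec
  generalize (⟨a K, a_mem K⟩ : R K) = aR at *
  generalize (⟨b K, b_mem K⟩ : R K) = bR at *
  generalize (⟨c K, c_mem K⟩ : R K) = cR at *
  generalize (⟨d K, d_mem K⟩ : R K) = dR at *
  generalize (⟨e K, e_mem K⟩ : R K) = eR at *
  fin_cases i <;> fin_cases j <;>
    simp [h₁, ha, hb, hc, hd, he, haa, hab, hac, had, hae, hba, hbb, hbc, hbd, hbe, hca, hcb, hcc, hcd, hce, hda, hdb, hdc, hdd, hde, hea, heb, hec, hed, hee, coeffX_one, coeffX_x,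
      coeffX_u, coeffX_v, coeffX_w, coeffX_y, coeffX_z, coeffX_u_mul_x]

theorem exists_hasInjectiveDimensionLE_R :
    ∃ n, CategoryTheory.HasInjectiveDimensionLE (ModuleCat.of (R K) (R K)) n := by
  obtain ⟨n, hn⟩ := MvPolynomial.exists_hasInjectiveDimensionLE K FreeIndex
  obtain ⟨φ, hφ⟩ := exists_dual K
  have := free_of_dual (span_basisVec K) hφ
  exact ⟨n, hasInjectiveDimensionLE_of_frobenius φ (bijective_of_dual (span_basisVec K) hφ) n
    (hasInjectiveDimensionLE_localization (freeMax K).primeCompl n hn)⟩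

theorem isGorensteinRing_R : IsGorensteinRing (R K) where
  isNoetherianRing := inferInstance
  exists_injectiveDimensionLE p _ := by
    obtain ⟨n, hn⟩ := exists_hasInjectiveDimensionLE_R K
    exact ⟨n, hasInjectiveDimensionLE_localization p.primeCompl n hn⟩

end Frobenius

end QuadricHypersurface

/-! ### `R` is the integral closure -/

namespace QuadricHypersurface

section IntegralClosure

variable {K : Type u} [Field K]

/-- In `A` the prime `z` does not divide `y`, so `zⁿ` divides `p`; comparing coefficients of `1, x`
brings the quotient back to `B`. -/
theorem zB_pow_dvd_of_dvd_mul {p q : B K} {n : ℕ} (h : yB K ^ n * p = zB K ^ n * q) :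
    zB K ^ n ∣ p := by
  have h₁ : y K ^ n * algebraMap (B K) (A K) p = z K ^ n * algebraMap (B K) (A K) q := by
    simpa only [map_mul, map_pow, algebraMap_yB, algebraMap_zB] using
      congrArg (algebraMap (B K) (A K)) h
  have hyz : ¬ z K ∣ y K ^ n := fun h =>
    not_coord_dvd_coord (by decide) ((prime_coord (Sum.inr 2)).dvd_of_dvd_pow h)
  obtain ⟨f, hf⟩ := (prime_coord (Sum.inr 2)).pow_dvd_of_dvd_mul_left n hyz ⟨_, h₁⟩
  obtain ⟨r, s, rfl⟩ := exists_eq_algebraMap_add_mul_x f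
  refine ⟨r, sub_eq_zero.1 (eq_zero_of_algebraMap_add_mul_x (q := -(zB K ^ n * s)) ?_).1⟩
  simp only [map_sub, map_neg, map_mul, map_pow, algebraMap_zB]
  rw [hf, z]
  ring

variable [CharP K 2]

/-- The dual basis extracts the coordinates of `g` over `B`, so the divisibility just proved applies
to each of them. -/
theorem exists_eq_z_pow_smul {g h : R K} {n : ℕ} (hgh : y K ^ n • g = z K ^ n • h) :
    ∃ f, g = z K ^ n • f := by
  obtain ⟨φ, hφ⟩ := exists_dual K
  obtain ⟨k, hk⟩ := (Submodule.mem_span_range_iff_exists_fun (B K)).1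
    (span_basisVec K (Submodule.mem_top (x := g)))
  have hy (f : R K) : y K ^ n • f = yB K ^ n • f := by
    rw [← algebraMap_yB, ← map_pow, algebraMap_smul]
  have hz (f : R K) : z K ^ n • f = zB K ^ n • f := by
    rw [← algebraMap_zB, ← map_pow, algebraMap_smul]
  rw [hy, hz] at hgh
  have hdvd (i : Fin 8) : zB K ^ n ∣ k i := by
    rw [← apply_sum_smul_mul_of_dual hφ k i, hk]
    refine zB_pow_dvd_of_dvd_mul (q := φ (h * dualVec K i)) ?_
    rw [← smul_eq_mul, ← map_smul, ← smul_mul_assoc, hgh, smul_mul_assoc, map_smul, smul_eq_mul]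
  choose l hl using hdvd
  refine ⟨∑ i, l i • basisVec K i, ?_⟩
  rw [hz, ← hk, Finset.smul_sum]
  exact Finset.sum_congr rfl fun i _ => by rw [hl, mul_smul]

variable (K)

theorem R_eq : R K = integralClosure (A K) (Ω K) ⊓
    (M K).toSubalgebra.restrictScalars (A K) := by
  refine le_antisymm (R_le K) fun f hf => ?_
  have hz := z_pow_three_smul_mem K hf.1 hf.2
  have hy := y_pow_three_smul_mem K hf.1 hf.2
  -- From `y³ (z³ f) = z³ (y³ f)`, with both brackets in `R`, it follows that `z³ f ∈ z³ R`.
  obtain ⟨g, hg⟩ := exists_eq_z_pow_smul (g := ⟨_, hz⟩) (h := ⟨_, hy⟩) (n := 3)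
    (Subtype.ext (smul_comm (y K ^ 3) (z K ^ 3) f))
  have hg' : z K ^ 3 • f = z K ^ 3 • (g : Ω K) := congrArg Subtype.val hg
  have : f = g := by
    rw [Algebra.smul_def, Algebra.smul_def] at hg'
    refine mul_left_cancel₀ ?_ hg'
    rw [Ne, map_eq_zero_iff _ algebraMap_A_injective]
    exact pow_ne_zero _ z_ne_zero
  rw [this]
  exact g.2

instance : IsIntegrallyClosed (R K) := by
  have : FiniteDimensional (L K) (M K) := Module.finite_of_finrank_pos (by simp [finrank_M])
  have : IsScalarTower (A K) (M K) (Ω K) := .of_algebraMap_eq fun _ => rfl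
  have : IsIntegrallyClosed (integralClosure (A K) (M K)) :=
    integralClosure.isIntegrallyClosedOfFiniteExtension (L K)
  have hR (r : R K) : (⟨r, (R_le K r.2).2⟩ : M K) ∈ integralClosure (A K) (M K) := by
    refine (isIntegral_algHom_iff (IsScalarTower.toAlgHom (A K) (M K) (Ω K))
      (algebraMap (M K) (Ω K)).injective).1 ?_
    exact (R_le K r.2).1
  let ι : R K →+* integralClosure (A K) (M K) :=
    { toFun := fun r => ⟨⟨r, (R_le K r.2).2⟩, hR r⟩
      map_one' := rfl
      map_mul' := fun _ _ => rfl
      map_zero' := rfl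
      map_add' := fun _ _ => rfl }
  refine IsIntegrallyClosed.of_equiv (RingEquiv.ofBijective ι ⟨fun r s h => ?_, fun f => ?_⟩).symm
  · exact Subtype.ext (congrArg (fun f : integralClosure (A K) (M K) => (f : Ω K)) h)
  · refine ⟨⟨f, ?_⟩, rfl⟩
    rw [R_eq]
    exact ⟨f.2.map (IsScalarTower.toAlgHom (A K) (M K) (Ω K)), f.1.2⟩

end IntegralClosure

end QuadricHypersurface

/-! ### Syzygies of `u, v, w` and the exact sequence -/

namespace QuadricHypersurface

open MvPolynomial

section ExactSequence

variable {K : Type u} [Field K]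

theorem exists_koszul_syzygy {i j k : Fin 3 ⊕ Fin 3} (hij : i ≠ j) (hik : i ≠ k) (hjk : j ≠ k)
    {p q r : Poly K} (h : p * X i + q * X j + r * X k = 0) : ∃ l m n : Poly K,
      p = l * X j - m * X k ∧ q = -l * X i - n * X k ∧ r = m * X i + n * X j := by
  have hr : r ∈ Ideal.span (X '' {i, j} : Set (Poly K)) := by
    refine (Ideal.IsPrime.mem_or_mem (isPrime_span_X_image {i, j}) (y := X k) ?_).resolve_right ?_
    · rw [Set.image_pair, Ideal.mem_span_pair]
      exact ⟨-p, -q, by linear_combination -h⟩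
    · intro hk
      rw [← ker_killVars, RingHom.mem_ker] at hk
      replace hk : killVars {i, j} (X k : Poly K) = 0 := hk
      rw [killVars_X_of_notMem (by simp [hik.symm, hjk.symm])] at hk
      exact X_ne_zero k hk
  rw [Set.image_pair, Ideal.mem_span_pair] at hr
  obtain ⟨m, n, rfl⟩ := hr
  have h₁ : (p + m * X k) * X i + (q + n * X k) * X j = 0 := by linear_combination h
  obtain ⟨l, hl⟩ : X j ∣ p + m * X k := by
    refine (X_prime.dvd_or_dvd (Dvd.intro_left (-(q + n * X k)) ?_)).resolve_right
      fun h => hij (X_dvd_X.1 h).symm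
    linear_combination -h₁
  refine ⟨l, m, n, by linear_combination hl, ?_, rfl⟩
  refine mul_right_cancel₀ (X_ne_zero (R := K) j) ?_
  linear_combination h₁ - X i * hl

variable [CharP K 2]

theorem exists_smul_d_of_polyToA {p q r : Poly K}
    (h : polyToA K p * u K + polyToA K q * v K + polyToA K r * w K = 0) :
    ∃ t : A K, polyToA K p • a K + polyToA K q • b K + polyToA K r • c K = t • d K := by
  have h₁ : polyToA K (p * X (Sum.inl 0) + q * X (Sum.inl 1) + r * X (Sum.inl 2)) = 0 := by
    simp only [map_add, map_mul, polyToA_X]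
    exact h
  obtain ⟨s, hs⟩ := (polyToA_eq_zero_iff _).1 h₁
  -- A relation modulo the quadric becomes an honest syzygy of `U, V, W` after subtracting `s (X, Y,
  -- Z)`, and such syzygies are Koszul.
  obtain ⟨l, m, n, h₂, h₃, h₄⟩ := exists_koszul_syzygy (i := Sum.inl 0) (j := Sum.inl 1)
    (k := Sum.inl 2) (p := p - s * X (Sum.inr 0)) (q := q - s * X (Sum.inr 1))
    (r := r - s * X (Sum.inr 2)) (by decide) (by decide) (by decide) (by
      rw [quadric] at hs
      linear_combination hs)
  have e₂ : polyToA K p = polyToA K l * v K - polyToA K m * w K + polyToA K s * x K := by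
    simpa only [map_add, map_sub, map_mul, polyToA_X] using!
      congrArg (polyToA K) (sub_eq_iff_eq_add.1 h₂)
  have e₃ : polyToA K q = -polyToA K l * u K - polyToA K n * w K + polyToA K s * y K := by
    simpa only [map_add, map_sub, map_neg, map_mul, polyToA_X] using!
      congrArg (polyToA K) (sub_eq_iff_eq_add.1 h₃)
  have e₄ : polyToA K r = polyToA K m * u K + polyToA K n * v K + polyToA K s * z K := by
    simpa only [map_add, map_sub, map_mul, polyToA_X] using!
      congrArg (polyToA K) (sub_eq_iff_eq_add.1 h₄)
  -- The Koszul syzygies contribute `va + ub = zd`, `wa + uc = yd`, `wb + vc = xd`, while `xa + yb +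
  -- zc = 0`.
  refine ⟨polyToA K l * z K + polyToA K m * y K + polyToA K n * x K, ?_⟩
  rw [e₂, e₃, e₄]
  have hc := z_smul_c K
  have hz := z_smul_d K
  have hy := y_smul_d K
  have hx := x_smul_d K
  linear_combination (norm := module) polyToA K s • hc - polyToA K l • hz - polyToA K m • hy -
    polyToA K n • hx + CharTwo.add_self_eq_zero (polyToA K s • (x K • a K + y K • b K) -
      (polyToA K l * u K) • b K - (polyToA K m * w K) • a K - (polyToA K n * w K) • b K)

theorem exists_smul_d {p q r : A K} (h : p * u K + q * v K + r * w K = 0) :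
    ∃ t : A K, p • a K + q • b K + r • c K = t • d K := by
  obtain ⟨s₁, hs₁, p', hp⟩ := exists_polyToA_mul_eq K p
  obtain ⟨s₂, hs₂, q', hq⟩ := exists_polyToA_mul_eq K q
  obtain ⟨s₃, hs₃, r', hr⟩ := exists_polyToA_mul_eq K r
  obtain ⟨σ, hσ⟩ := ((isUnit_polyToA K hs₁).mul (isUnit_polyToA K hs₂)).mul (isUnit_polyToA K hs₃)
  have hp' : polyToA K (s₂ * s₃ * p') = σ * p := by
    rw [map_mul, map_mul, ← hp, hσ]; ring
  have hq' : polyToA K (s₁ * s₃ * q') = σ * q := by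
    rw [map_mul, map_mul, ← hq, hσ]; ring
  have hr' : polyToA K (s₁ * s₂ * r') = σ * r := by
    rw [map_mul, map_mul, ← hr, hσ]; ring
  obtain ⟨t, ht⟩ := exists_smul_d_of_polyToA (p := s₂ * s₃ * p') (q := s₁ * s₃ * q')
    (r := s₁ * s₂ * r') (by rw [hp', hq', hr']; linear_combination (σ : A K) * h)
  rw [hp', hq', hr', mul_smul, mul_smul, mul_smul, ← smul_add, ← smul_add] at ht
  refine ⟨↑σ⁻¹ * t, ?_⟩
  rw [mul_smul, ← ht, smul_smul, Units.inv_mul, one_smul]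

variable (K)

theorem exists_exact_sequence :
    ∃ (f : (Fin 3 → A K) →ₗ[A K] R K) (g : R K →ₗ[A K] P K),
      Function.Injective f ∧ Function.Exact f g ∧ Function.Surjective g ∧ g 1 = 0 ∧
      (g ⟨a K, a_mem K⟩ : A K) = u K ∧ (g ⟨b K, b_mem K⟩ : A K) = v K ∧
      (g ⟨c K, c_mem K⟩ : A K) = w K ∧ g ⟨d K, d_mem K⟩ = 0 ∧ g ⟨e K, e_mem K⟩ = 0 := by
  obtain ⟨G, h₁, ha, hb, hc, hd, he⟩ := exists_functional_u_v_w K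
  have hG (p₀ p₁ p₂ p₃ p₄ p₅ : A K) : G (p₀ • 1 + p₁ • ⟨a K, a_mem K⟩ + p₂ • ⟨b K, b_mem K⟩ +
      p₃ • ⟨c K, c_mem K⟩ + p₄ • ⟨d K, d_mem K⟩ + p₅ • ⟨e K, e_mem K⟩) =
        p₁ * u K + p₂ * v K + p₃ * w K := by
    simp only [map_add, map_smul, h₁, ha, hb, hc, hd, he, smul_eq_mul, mul_zero, zero_add, add_zero]
  have hR (r : R K) : ∃ p₀ p₁ p₂ p₃ p₄ p₅ : A K, r = p₀ • 1 + p₁ • ⟨a K, a_mem K⟩ +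
      p₂ • ⟨b K, b_mem K⟩ + p₃ • ⟨c K, c_mem K⟩ + p₄ • ⟨d K, d_mem K⟩ + p₅ • ⟨e K, e_mem K⟩ := by
    obtain ⟨p₀, p₁, p₂, p₃, p₄, p₅, h⟩ := (mem_R_iff K).1 r.2
    exact ⟨p₀, p₁, p₂, p₃, p₄, p₅, Subtype.ext h⟩
  have hP (r : R K) : G r ∈ P K := by
    obtain ⟨p₀, p₁, p₂, p₃, p₄, p₅, rfl⟩ := hR r
    rw [hG]
    exact Submodule.mem_span_triple.2 ⟨p₁, p₂, p₃, rfl⟩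
  let f : (Fin 3 → A K) →ₗ[A K] R K :=
    Fintype.linearCombination (A K) ![1, ⟨e K, e_mem K⟩, ⟨d K, d_mem K⟩]
  have hf (p : Fin 3 → A K) : f p = p 0 • 1 + p 1 • ⟨e K, e_mem K⟩ + p 2 • ⟨d K, d_mem K⟩ := by
    rw [Fintype.linearCombination_apply, Fin.sum_univ_three]
    rfl
  refine ⟨f, LinearMap.codRestrict (P K) G hP, ?_, ?_, ?_, Subtype.ext h₁, ha, hb, hc,
    Subtype.ext hd, Subtype.ext he⟩
  · refine (injective_iff_map_eq_zero f).2 fun p hp => ?_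
    rw [hf] at hp
    have hp' : p 0 • (1 : Ω K) + p 1 • e K + p 2 • d K = 0 := congrArg Subtype.val hp
    -- Multiplying by `z` and replacing `z d` by `v a + u b` turns the relation into one between the
    -- independent elements `1, a, b, e`.
    obtain ⟨h₀, -, h₂, h₁⟩ := eq_zero_of_smul_add_eq_zero (p := z K * p 0) (q := p 2 * v K)
        (r := p 2 * u K) (s := z K * p 1) (by
      have := z_smul_d K
      linear_combination (norm := module) z K • hp' - p 2 • this)
    funext i
    fin_cases i
    exacts [(mul_eq_zero.1 h₀).resolve_left z_ne_zero, (mul_eq_zero.1 h₁).resolve_left z_ne_zero,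
      (mul_eq_zero.1 h₂).resolve_right (coord_ne_zero _)]
  · intro r
    constructor
    · intro hr
      obtain ⟨p₀, p₁, p₂, p₃, p₄, p₅, rfl⟩ := hR r
      have hr' := congrArg Subtype.val hr
      obtain ⟨t, ht⟩ := exists_smul_d ((hG _ _ _ _ _ _).symm.trans hr')
      refine ⟨![p₀, p₅, t + p₄], (hf _).trans (Subtype.ext ?_)⟩
      change p₀ • (1 : Ω K) + p₅ • e K + (t + p₄) • d K =
        p₀ • 1 + p₁ • a K + p₂ • b K + p₃ • c K + p₄ • d K + p₅ • e K
      linear_combination (norm := module) -ht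
    · rintro ⟨p, rfl⟩
      refine Subtype.ext ?_
      rw [hf]
      change G _ = 0
      simp only [map_add, map_smul, h₁, he, hd, smul_zero, add_zero]
  · rintro ⟨q, hq⟩
    obtain ⟨p₁, p₂, p₃, hq'⟩ := Submodule.mem_span_triple.1 hq
    exact ⟨_, Subtype.ext ((hG 0 p₁ p₂ p₃ 0 0).trans hq')⟩

end ExactSequence

end QuadricHypersurface

theorem mainTheorem5 (K : Type u) [Field K] [CharP K 2] :
    -- `R` is a Gorenstein normal domain
    IsGorensteinRing (QuadricHypersurface.R K) ∧
    IsDomain (QuadricHypersurface.R K) ∧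
    IsIntegrallyClosed (QuadricHypersurface.R K) ∧
    -- `R` is the integral closure of `A` in the biquadratic extension `L(√(uyz), √(vxz))` of `L`
    Module.finrank (QuadricHypersurface.L K) (QuadricHypersurface.M K) = 4 ∧
    QuadricHypersurface.R K =
      integralClosure (QuadricHypersurface.A K) (QuadricHypersurface.Ω K) ⊓
        (QuadricHypersurface.M K).toSubalgebra.restrictScalars (QuadricHypersurface.A K) ∧
    -- `R` is a finite `A`-module, generated by `1, a, b, c, d, e`, of rank `4`
    Module.Finite (QuadricHypersurface.A K) (QuadricHypersurface.R K) ∧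
    Subalgebra.toSubmodule (QuadricHypersurface.R K) =
      Submodule.span (QuadricHypersurface.A K)
        {1, QuadricHypersurface.a K, QuadricHypersurface.b K, QuadricHypersurface.c K,
          QuadricHypersurface.d K, QuadricHypersurface.e K} ∧
    Module.rank (QuadricHypersurface.A K) (QuadricHypersurface.R K) = 4 ∧
    -- `P` is prime, and there is an exact sequence `0 → A³ → R → P → 0` whose map `R → P` is
    -- determined by `1 ↦ 0, a ↦ u, b ↦ v, c ↦ w, d ↦ 0, e ↦ 0`
    (QuadricHypersurface.P K).IsPrime ∧
    ∃ (f : (Fin 3 → QuadricHypersurface.A K) →ₗ[QuadricHypersurface.A K] QuadricHypersurface.R K)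
      (g : QuadricHypersurface.R K →ₗ[QuadricHypersurface.A K] QuadricHypersurface.P K),
      Function.Injective f ∧ Function.Exact f g ∧ Function.Surjective g ∧
      g 1 = 0 ∧
      (g ⟨QuadricHypersurface.a K, QuadricHypersurface.a_mem K⟩ : QuadricHypersurface.A K) =
        QuadricHypersurface.u K ∧
      (g ⟨QuadricHypersurface.b K, QuadricHypersurface.b_mem K⟩ : QuadricHypersurface.A K) =
        QuadricHypersurface.v K ∧
      (g ⟨QuadricHypersurface.c K, QuadricHypersurface.c_mem K⟩ : QuadricHypersurface.A K) =
        QuadricHypersurface.w K ∧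
      g ⟨QuadricHypersurface.d K, QuadricHypersurface.d_mem K⟩ = 0 ∧
      g ⟨QuadricHypersurface.e K, QuadricHypersurface.e_mem K⟩ = 0 :=
  ⟨QuadricHypersurface.isGorensteinRing_R K, inferInstance, inferInstance,
    QuadricHypersurface.finrank_M K, QuadricHypersurface.R_eq K, inferInstance,
    QuadricHypersurface.toSubmodule_R K, QuadricHypersurface.rank_R K,
    QuadricHypersurface.isPrime_P, QuadricHypersurface.exists_exact_sequence K⟩
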